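/- Let $\mathbb X,\mathbb Y,\mathbb Z,\mathbb S$ be finite alphabets, $\mathbb S\neq\emptyset$. A *type* on a finite alphabet is the empirical distribution of some finite nonempty sequence (equivalently, a rational-valued PMF); $\mathbf P^e(\cdot)$ denotes the set of types. A *conditional type* on $B$ given $A$ is a conditional PMF of the form $J(b|a)=N_o(a,b|\mathbf x,\mathbf y)/N_o(a|\mathbf x)$ for sequences $\mathbf x,\mathbf y$ of equal length in which every $a\in A$ occurs in $\mathbf x$, where $N_o$ counts occurrences (equivalently, a rational-valued conditional PMF). Let $p_{Y,Z|X,S}$ be a compound discrete memoryless channel, with input $X$, outputs $Y$ (seen by the decoder) and $Z$ (interference seen by an external observer) and state $S$ fixed during the block and unknown to encoder and decoder, and assume that $p_{Y,Z|X,S}$ is a conditional type on $\mathbb Y\times\mathbb Z$ given $\mathbb X\times\mathbb S$. For $s\in\mathbb S$ let $J_s=p_{Y|X,S}(\cdot|\cdot,s)$ and $K_s=p_{Z|X,S}(\cdot|\cdot,s)$ be its marginal channels. A $(2^{nR},n)$-code, $R\ge 0$, consists of an encoder $\{1,\dots,\lceil 2^{nR}\rceil\}\to\mathbb X^n$ and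 a decoder $\mathbb Y^n\to\{1,\dots,\lceil 2^{nR}\rceil\}$; the message $M$ is uniform. The rate $R\ge0$ is *multiply achievable* with the types $(Q_s)_{s\in\mathbb S}\in\mathbf P^e(\mathbb Z)^{\mathbb S}$ if there is a sequence of $(2^{nR},n)$-codes such that $\lim_{n\to\infty}\max_{s}\Pr(\hat M\ne M\mid s)=0$ and, for every $s$, if the state is $s$, then $\sum_{c\in\mathbb Z}|Q_s(c)-P_{\mathbf z}(c)|\to0$ in probability, where $P_{\mathbf z}$ is the type of the interference sequence $\mathbf z\in\mathbb Z^n$. The communication–multiple-interference capacity region $C$ is the closure in $\mathbb R\times(\mathbb R^{\mathbb Z})^{\mathbb S}$ of the set of all tuples $(R,(Q_s)_{s})$ such that $R$ is multiply achievable with $(Q_s)_s$. For $Q\in\mathbf P^e(\mathbb Z)$ let $\mathbf P_{pim}(Q,K_s)=\{N\in\mathbf P^e(\mathbb X):\sum_a N(a)K_s(\cdot|a)=Q\}$, and let $I(NJ_s)$ be the mutual information, in bits, of the joint distribution $N(a)J_s(b|a)$. **Theorem.** The region $C$ is the closure of the set of all tuples $(R,(Q_s)_{s})$ with $R\ge0$,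 $Q_s\in\mathbf P^e(\mathbb Z)$ for all $s$, $\bigcap_{s}\mathbf P_{pim}(Q_s,K_s)\neq\emptyset$ and $$R\le\sup_{N\in\bigcap_{s}\mathbf P_{pim}(Q_s,K_s)}\ \min_{s\in\mathbb S}I(NJ_s).$$ Moreover, for every $(Q_s)_s\in\mathbf P^e(\mathbb Z)^{\mathbb S}$ with $\bigcap_{s}\mathbf P_{pim}(Q_s,K_s)\neq\emptyset$, this supremum is finite and equals the maximum, which is attained, of $\min_s I(NJ_s)$ over all (real-valued) PMFs $N$ on $\mathbb X$ with $\sum_aN(a)K_s(\cdot|a)=Q_s$ for every $s$. -/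

import Mathlib

noncomputable section

namespace CompoundInterference

open Filter Topology

/-! ### Types and conditional types -/

open Classical in
/-- Number of occurrences of the symbol `a` in the sequence `x`. -/
def occ {A : Type*} {n : ℕ} (x : Fin n → A) (a : A) : ℕ :=
  (Finset.univ.filter fun i => x i = a).card

/-- The type (empirical distribution) of a sequence. -/
def seqType {A : Type*} {n : ℕ} (x : Fin n → A) : A → ℝ :=
  fun a => (occ x a : ℝ) / (n : ℝ)

/-- The set of all types on `A`, with arbitrary positive denominator. -/
def types (A : Type*) : Set (A → ℝ) :=
  {P | ∃ n : ℕ, 0 < n ∧ ∃ x : Fin n → A, P = seqType x}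

/-- The set of all conditional types on `B` given `A` that are defined at every symbol of `A`:
`J(b|a)` is the number of occurrences of `(a, b)` in a pair of sequences of equal positive length
divided by the number of occurrences of `a`, and every `a` occurs. -/
def condTypes (A B : Type*) : Set (A → B → ℝ) :=
  {J | ∃ n : ℕ, 0 < n ∧ ∃ (x : Fin n → A) (y : Fin n → B), (∀ a, 0 < occ x a) ∧
    ∀ a b, J a b = (occ (fun i => (x i, y i)) (a, b) : ℝ) / (occ x a : ℝ)}

/-- The set of all probability mass functions on a finite alphabet. -/
def pmfs (A : Type*) [Fintype A] : Set (A → ℝ) :=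
  {P | (∀ a, 0 ≤ P a) ∧ ∑ a, P a = 1}

/-- Variational distance. -/
def variational {A : Type*} [Fintype A] (P Q : A → ℝ) : ℝ := ∑ a, |P a - Q a|

/-- The output distribution `∑ₐ N(a) K(·|a)`. -/
def output {A B : Type*} [Fintype A] (N : A → ℝ) (K : A → B → ℝ) : B → ℝ :=
  fun b => ∑ a, N a * K a b

/-- The pre-image of `Q` under `K`: all types `N` on the input alphabet whose output
distribution is `Q`. -/
def preimage {A B : Type*} [Fintype A] (Q : B → ℝ) (K : A → B → ℝ) : Set (A → ℝ) :=
  {N | N ∈ types A ∧ output N K = Q}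

/-- The joint distribution `N J` on `A × B`. -/
def joint {A B : Type*} (N : A → ℝ) (J : A → B → ℝ) : A × B → ℝ :=
  fun ab => N ab.1 * J ab.1 ab.2

/-- Mutual information (in bits) of a joint distribution: the divergence from the product of
its marginals. -/
def mutualInfo {A B : Type*} [Fintype A] [Fintype B] (P : A × B → ℝ) : ℝ :=
  ∑ a, ∑ b, P (a, b) * Real.logb 2 (P (a, b) / ((∑ b', P (a, b')) * ∑ a', P (a', b)))

/-! ### Compound channel and codes

A compound channel is a function `p`, where `p (a, s) (b, c)` is the probability of the output
pair `(b, c)` given input `a` in state `s`. -/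

/-- Marginal channel from the input to the receiver's output, in state `s`. -/
def chanY {X Y Z S : Type*} [Fintype Z] (p : X × S → Y × Z → ℝ) (s : S) : X → Y → ℝ :=
  fun a b => ∑ c, p (a, s) (b, c)

/-- Marginal channel from the input to the interference observed externally, in state `s`. -/
def chanZ {X Y Z S : Type*} [Fintype Y] (p : X × S → Y × Z → ℝ) (s : S) : X → Z → ℝ :=
  fun a c => ∑ b, p (a, s) (b, c)

/-- A code of blocklength `n` with `M` messages. -/
structure Code (X Y : Type*) (M n : ℕ) where
  enc : Fin M → Fin n → X
  dec : (Fin n → Y) → Fin M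

/-- Number of messages of a `(2^{nR}, n)` code, `⌈2^{nR}⌉`. -/
def numMessages (R : ℝ) (n : ℕ) : ℕ := ⌈(2 : ℝ) ^ ((n : ℝ) * R)⌉₊

open Classical in
/-- Probability of the event `E` (on message, receiver's sequence, interference sequence) when the
message is uniform, the code `c` is used, and the memoryless channel is in the same state `s`
during the whole block. -/
def prob {X Y Z S : Type*} [Fintype Y] [Fintype Z] (p : X × S → Y × Z → ℝ) (s : S)
    {M n : ℕ} (c : Code X Y M n) (E : Fin M → (Fin n → Y) → (Fin n → Z) → Prop) : ℝ :=
  (∑ m, ∑ y : Fin n → Y, ∑ z : Fin n → Z,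
    if E m y z then ∏ i, p (c.enc m i, s) (y i, z i) else 0) / (M : ℝ)

/-- The rate `R` is multiply achievable with the tuple `Q` of interference types: some sequence
of `(2^{nR}, n)` codes has error probability, maximised over the states, tending to `0`, and
in each state `s` the type of the interference sequence tends to `Q s` in probability. The
encoder and the decoder do not depend on the state. -/
def MultiplyAchievable {X Y Z S : Type*} [Fintype Y] [Fintype Z]
    (p : X × S → Y × Z → ℝ) (R : ℝ) (Q : S → Z → ℝ) : Prop :=
  ∃ c : (n : ℕ) → Code X Y (numMessages R n) n,
    Tendsto (fun n => ⨆ s, prob p s (c n) fun m y _ => (c n).dec y ≠ m) atTop (𝓝 0) ∧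
    ∀ s, ∀ ε > 0,
      Tendsto (fun n => prob p s (c n) fun _ _ z => ε ≤ variational (Q s) (seqType z))
        atTop (𝓝 0)

/-- The communication–multiple-interference capacity region, a closed subset of
`ℝ × (S → Z → ℝ)`. -/
def capacityRegion {X Y Z S : Type*} [Fintype Y] [Fintype Z]
    (p : X × S → Y × Z → ℝ) : Set (ℝ × (S → Z → ℝ)) :=
  closure {t | 0 ≤ t.1 ∧ (∀ s, t.2 s ∈ types Z) ∧ MultiplyAchievable p t.1 t.2}

/-- The intersection over the states of the pre-images of the interference types. -/
def commonPreimage {X Y Z S : Type*} [Fintype X] [Fintype Y]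
    (p : X × S → Y × Z → ℝ) (Q : S → Z → ℝ) : Set (X → ℝ) :=
  ⋂ s, preimage (Q s) (chanZ p s)

/-- The least mutual information over the states for the input distribution `N`. -/
def minInfo {X Y Z S : Type*} [Fintype X] [Fintype Y] [Fintype Z]
    (p : X × S → Y × Z → ℝ) (N : X → ℝ) : ℝ :=
  ⨅ s, mutualInfo (joint N (chanY p s))

end CompoundInterference

end

/-!
Achievability. For an input PMF `N` and a rate below `I(N J_s)` for every `s`, draw the codewords
independently from the product of `N`, and decode to a codeword that passes, for at least one state
`s`, the likelihood-ratio test of the memoryless channel `J_s` against its output distribution. By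
Chebyshev's inequality the sent codeword passes the test of the true state, and by Markov's
inequality another codeword passes one of the `|S|` tests with exponentially small probability.
The interference sequence of a random codeword is a sequence of independent symbols with
distribution `Q_s`, so that the mean square deviation of its type from `Q_s` is `O(1/n)`. All these
averages are nonnegative, hence some codebook makes all of them small for all states at once.

Converse. Let `N_n` be the average of the types of the codewords. Gibbs' inequality, applied to the
pair of message and output sequence against an independent guess of the message, bounds the rate
by `I(N_n J_s)` up to `o(1)`. The mean type of the interference sequence is the output distribution
of `K_s` under `N_n`, and convergence in probability of bounded variables implies convergence of
their means, so every limit point of `N_n` has the output distributions `Q_s`.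

The limit point is a PMF, not a type. A `ℚ`-linear map from `ℝ` to `ℚ` that is close to the identity
on the finitely many values of `N` turns `N`, after normalisation, into a nearby type with the same
output distributions, since the entries of `K_s` and `Q_s` are rational. Types are therefore dense
among the PMFs with the output distributions `Q_s`, and the supremum over types is the maximum over
PMFs by continuity of the mutual information and compactness.
-/

noncomputable section

namespace CompoundInterference

open Filter Topology

section Expectation

variable {A B κ : Type*} [Fintype A] [Fintype B]

/-- The expectation of `f` under the mass function `P` on a finite alphabet. -/
def expect (P f : A → ℝ) : ℝ := ∑ a, P a * f a

/-- The probability of the event `E` under the mass function `P` on a finite alphabet. -/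
def mass (P : A → ℝ) (E : Set A) : ℝ := expect P (E.indicator 1)

/-- The uniform mass function on a finite alphabet; it is a PMF unless the alphabet is empty. -/
def uniform (A : Type*) [Fintype A] : A → ℝ := fun _ => (Fintype.card A : ℝ)⁻¹

/-- A channel from `A` to `B`: a family of PMFs on `B` indexed by the input symbols. -/
def IsChannel {A : Type*} (J : A → B → ℝ) : Prop := ∀ a, J a ∈ pmfs B

theorem expect_const {P : A → ℝ} (hP : P ∈ pmfs A) (r : ℝ) : expect P (fun _ => r) = r := by
  rw [expect, ← Finset.sum_mul, hP.2, one_mul]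

theorem expect_add (P f g : A → ℝ) :
    expect P (fun a => f a + g a) = expect P f + expect P g := by
  simp only [expect, mul_add, Finset.sum_add_distrib]

theorem expect_sub (P f g : A → ℝ) :
    expect P (fun a => f a - g a) = expect P f - expect P g := by
  simp only [expect, mul_sub, Finset.sum_sub_distrib]

theorem expect_const_mul (P : A → ℝ) (r : ℝ) (f : A → ℝ) :
    expect P (fun a => r * f a) = r * expect P f := by
  simp only [expect, Finset.mul_sum, mul_left_comm]

theorem expect_mul_const (P f : A → ℝ) (r : ℝ) :
    expect P (fun a => f a * r) = expect P f * r := by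
  simp only [expect, Finset.sum_mul, mul_assoc]

theorem expect_sum (P : A → ℝ) (t : Finset κ) (f : κ → A → ℝ) :
    expect P (fun a => ∑ k ∈ t, f k a) = ∑ k ∈ t, expect P (f k) := by
  simp only [expect, Finset.mul_sum]
  exact Finset.sum_comm

theorem expect_comm (P : A → ℝ) (Q : B → ℝ) (f : A → B → ℝ) :
    expect P (fun a => expect Q (f a)) = expect Q fun b => expect P fun a => f a b := by
  simp only [expect, Finset.mul_sum, mul_left_comm (P _)]
  exact Finset.sum_comm

theorem expect_mono {P : A → ℝ} (hP : ∀ a, 0 ≤ P a) {f g : A → ℝ}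
    (h : ∀ a, 0 < P a → f a ≤ g a) : expect P f ≤ expect P g := by
  refine Finset.sum_le_sum fun a _ => ?_
  rcases (hP a).eq_or_lt with h0 | h0
  · simp [← h0]
  · exact mul_le_mul_of_nonneg_left (h a h0) (hP a)

theorem expect_congr {P : A → ℝ} (hP : ∀ a, 0 ≤ P a) {f g : A → ℝ}
    (h : ∀ a, 0 < P a → f a = g a) : expect P f = expect P g :=
  le_antisymm (expect_mono hP fun a ha => (h a ha).le) (expect_mono hP fun a ha => (h a ha).ge)

theorem expect_nonneg {P f : A → ℝ} (hP : ∀ a, 0 ≤ P a) (hf : ∀ a, 0 ≤ f a) : 0 ≤ expect P f :=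
  Finset.sum_nonneg fun a _ => mul_nonneg (hP a) (hf a)

theorem expect_uniform (f : A → ℝ) : expect (uniform A) f = (∑ a, f a) / Fintype.card A := by
  simp only [expect, uniform, ← Finset.mul_sum, div_eq_inv_mul]

theorem expect_joint (N : A → ℝ) (J : A → B → ℝ) (f : A × B → ℝ) :
    expect (joint N J) f = expect N fun a => expect (J a) fun b => f (a, b) := by
  simp only [expect, joint, Fintype.sum_prod_type, Finset.mul_sum, mul_assoc]

theorem expect_output (N : A → ℝ) (J : A → B → ℝ) (f : B → ℝ) :
    expect (output N J) f = expect N fun a => expect (J a) f := by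
  simp only [expect, output, Finset.sum_mul, Finset.mul_sum, mul_assoc]
  exact Finset.sum_comm

theorem uniform_mem_pmfs [Nonempty A] : uniform A ∈ pmfs A :=
  ⟨fun _ => by rw [uniform]; positivity, by simp [uniform]⟩

theorem joint_mem_pmfs {N : A → ℝ} (hN : N ∈ pmfs A) {J : A → B → ℝ} (hJ : IsChannel J) :
    joint N J ∈ pmfs (A × B) := by
  refine ⟨fun ab => mul_nonneg (hN.1 _) ((hJ _).1 _), ?_⟩
  simp [joint, Fintype.sum_prod_type, ← Finset.mul_sum, (hJ _).2, hN.2]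

theorem output_mem_pmfs {N : A → ℝ} (hN : N ∈ pmfs A) {J : A → B → ℝ} (hJ : IsChannel J) :
    output N J ∈ pmfs B := by
  refine ⟨fun b => Finset.sum_nonneg fun a _ => mul_nonneg (hN.1 a) ((hJ a).1 b), ?_⟩
  simp only [output]
  rw [Finset.sum_comm]
  simp only [← Finset.mul_sum, (hJ _).2, mul_one, hN.2]

theorem output_pos {N : A → ℝ} (hN : ∀ a, 0 ≤ N a) {J : A → B → ℝ} (hJ : IsChannel J)
    {a : A} {b : B} (ha : 0 < N a) (hb : 0 < J a b) : 0 < output N J b :=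
  Finset.sum_pos' (fun a' _ => mul_nonneg (hN a') ((hJ a').1 b))
    ⟨a, Finset.mem_univ a, mul_pos ha hb⟩

theorem mass_singleton (P : A → ℝ) (a : A) : mass P {a} = P a := by
  classical
  simp [mass, expect, Set.indicator_apply]

theorem mass_nonneg {P : A → ℝ} (hP : ∀ a, 0 ≤ P a) (E : Set A) : 0 ≤ mass P E :=
  expect_nonneg hP fun _ => Set.indicator_nonneg (fun _ _ => zero_le_one) _

theorem mass_mono {P : A → ℝ} (hP : ∀ a, 0 ≤ P a) {E F : Set A}
    (h : ∀ a, 0 < P a → a ∈ E → a ∈ F) : mass P E ≤ mass P F :=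
  expect_mono hP fun a ha => by
    by_cases hE : a ∈ E
    · simp [hE, h a ha hE]
    · simpa [hE] using Set.indicator_nonneg (s := F) (f := 1) (fun _ _ => zero_le_one) a

theorem mass_compl {P : A → ℝ} (hP : P ∈ pmfs A) (E : Set A) : mass P Eᶜ = 1 - mass P E := by
  rw [mass, mass, ← expect_const hP 1, ← expect_sub, Set.indicator_compl]
  rfl

theorem mass_le_one {P : A → ℝ} (hP : P ∈ pmfs A) (E : Set A) : mass P E ≤ 1 :=
  sub_nonneg.1 (mass_compl hP E ▸ mass_nonneg hP.1 Eᶜ)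

theorem mass_union_le {P : A → ℝ} (hP : ∀ a, 0 ≤ P a) (E F : Set A) :
    mass P (E ∪ F) ≤ mass P E + mass P F := by
  rw [mass, mass, mass, ← expect_add]
  refine expect_mono hP fun a _ => ?_
  by_cases hE : a ∈ E <;> by_cases hF : a ∈ F <;> simp [hE, hF]

theorem mass_iUnion_le [Fintype κ] {P : A → ℝ} (hP : ∀ a, 0 ≤ P a) (E : κ → Set A) :
    mass P (⋃ k, E k) ≤ ∑ k, mass P (E k) := by
  have hE (k : κ) (a : A) : 0 ≤ (E k).indicator (1 : A → ℝ) a :=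
    Set.indicator_nonneg (fun _ _ => zero_le_one) a
  simp only [mass, ← expect_sum]
  refine expect_mono hP fun a _ => ?_
  by_cases ha : a ∈ ⋃ k, E k
  · obtain ⟨k, hk⟩ := Set.mem_iUnion.1 ha
    calc (⋃ k, E k).indicator (1 : A → ℝ) a = (E k).indicator 1 a := by simp [ha, hk]
      _ ≤ ∑ k, (E k).indicator 1 a :=
        Finset.single_le_sum (fun k _ => hE k a) (Finset.mem_univ k)
  · rw [Set.indicator_of_notMem ha]
    exact Finset.sum_nonneg fun k _ => hE k a

theorem mul_mass_le_expect {P f : A → ℝ} (hP : ∀ a, 0 ≤ P a) (hf : ∀ a, 0 ≤ f a) (r : ℝ) :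
    r * mass P {a | r ≤ f a} ≤ expect P f := by
  rw [mass, ← expect_const_mul]
  refine expect_mono hP fun a _ => ?_
  by_cases h : r ≤ f a <;> simp [h, hf a]

theorem abs_expect_sub_le {P : A → ℝ} (hP : P ∈ pmfs A) {f : A → ℝ} {r ε : ℝ} {E : Set A}
    (hε : 0 ≤ ε) (hf : ∀ a, |f a - r| ≤ 1) (hE : ∀ a ∉ E, |f a - r| ≤ ε) :
    |expect P f - r| ≤ ε + mass P E :=
  calc |expect P f - r| = |expect P fun a => f a - r| := by rw [expect_sub, expect_const hP]
    _ ≤ expect P fun a => |f a - r| := by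
      refine (Finset.abs_sum_le_sum_abs _ _).trans_eq (Finset.sum_congr rfl fun a _ => ?_)
      rw [abs_mul, abs_of_nonneg (hP.1 a)]
    _ ≤ expect P fun a => ε + E.indicator 1 a := expect_mono hP.1 fun a _ => by
      by_cases ha : a ∈ E
      · simpa [ha] using (hf a).trans (le_add_of_nonneg_left hε)
      · simpa [ha] using hE a ha
    _ = ε + mass P E := by rw [expect_add, expect_const hP, mass]

theorem exists_forall_le_of_expect_le [Fintype κ] {P : A → ℝ} (hP : P ∈ pmfs A)
    {F : κ → A → ℝ} {r : κ → ℝ} (hF : ∀ k a, 0 ≤ F k a) (h : ∀ k, expect P (F k) ≤ r k) :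
    ∃ a, ∀ k, F k a ≤ ∑ k, r k := by
  by_contra! hlt
  have hA : Nonempty A := by
    by_contra hA
    rw [not_nonempty_iff] at hA
    exact zero_ne_one ((Fintype.sum_empty P).symm.trans hP.2)
  have hsum (a : A) : ∑ k, r k < ∑ k, F k a := by
    obtain ⟨k, hk⟩ := hlt a
    exact hk.trans_le (Finset.single_le_sum (fun k _ => hF k a) (Finset.mem_univ k))
  obtain ⟨a, -, ha⟩ := Finset.exists_min_image Finset.univ (fun a => ∑ k, F k a)
    Finset.univ_nonempty
  refine (hsum a).not_ge ?_
  calc ∑ k, F k a = expect P fun _ => ∑ k, F k a := (expect_const hP _).symm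
    _ ≤ expect P fun a => ∑ k, F k a := expect_mono hP.1 fun a' _ => ha a' (Finset.mem_univ a')
    _ = ∑ k, expect P (F k) := expect_sum _ _ _
    _ ≤ ∑ k, r k := Finset.sum_le_sum fun k _ => h k

end Expectation

section Product

variable {ι A B : Type*} [Fintype ι] [Fintype A] [Fintype B]

/-- The mass function of a sequence of independent symbols, the `i`-th of them drawn from `W i`. -/
def prodMass (W : ι → B → ℝ) : (ι → B) → ℝ := fun x => ∏ i, W i (x i)

/-- The memoryless extension of the channel `J` to sequences. -/
def memoryless {A : Type*} (J : A → B → ℝ) : (ι → A) → (ι → B) → ℝ :=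
  fun x => prodMass fun i => J (x i)

/-- The variance of `f` under the mass function `P`. -/
def variance (P f : A → ℝ) : ℝ := expect P fun a => (f a - expect P f) ^ 2

theorem prodMass_pos {B : Type*} {W : ι → B → ℝ} (hW : ∀ i b, 0 ≤ W i b) {x : ι → B}
    (hx : 0 < prodMass W x) (i : ι) : 0 < W i (x i) :=
  (hW i (x i)).lt_of_ne' fun h => hx.ne' (Finset.prod_eq_zero (Finset.mem_univ i) h)

variable [DecidableEq ι]

theorem expect_prodMass_prod (W f : ι → B → ℝ) :
    expect (prodMass W) (fun x => ∏ i, f i (x i)) = ∏ i, expect (W i) (f i) := by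
  simp only [expect, prodMass, ← Finset.prod_mul_distrib, Fintype.prod_sum]

theorem prodMass_mem_pmfs {W : ι → B → ℝ} (hW : ∀ i, W i ∈ pmfs B) :
    prodMass W ∈ pmfs (ι → B) := by
  refine ⟨fun x => Finset.prod_nonneg fun i _ => (hW i).1 _, ?_⟩
  simp only [prodMass, ← Fintype.prod_sum, (hW _).2, Finset.prod_const_one]

theorem isChannel_memoryless {A : Type*} {J : A → B → ℝ} (hJ : IsChannel J) :
    IsChannel (memoryless J : (ι → A) → (ι → B) → ℝ) :=
  fun _ => prodMass_mem_pmfs fun _ => hJ _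

theorem expect_prodMass_apply {W : ι → B → ℝ} (hW : ∀ i, W i ∈ pmfs B) (i : ι) (f : B → ℝ) :
    expect (prodMass W) (fun x => f (x i)) = expect (W i) f := by
  have h := expect_prodMass_prod W fun j b => if j = i then f b else 1
  simp only [Fintype.prod_ite_eq'] at h
  rw [h, Fintype.prod_eq_single i fun j hj => by simp only [if_neg hj, expect_const (hW j)]]
  simp only [if_true]

theorem expect_prodMass_mul {W : ι → B → ℝ} (hW : ∀ i, W i ∈ pmfs B) {i j : ι} (hij : i ≠ j)
    (f g : B → ℝ) :
    expect (prodMass W) (fun x => f (x i) * g (x j)) = expect (W i) f * expect (W j) g := by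
  have h := expect_prodMass_prod W fun k b => if k = i then f b else if k = j then g b else 1
  rw [Fintype.prod_eq_mul i j hij fun k hk => by simp only [if_neg hk.1, if_neg hk.2,
    expect_const (hW k)]] at h
  simp only [if_true, if_neg hij.symm] at h
  rw [← h]
  congr 1 with x
  rw [Fintype.prod_eq_mul i j hij fun k hk => by simp only [if_neg hk.1, if_neg hk.2]]
  simp only [if_true, if_neg hij.symm]

theorem output_prodMass {B : Type*} (N : ι → A → ℝ) (J : A → B → ℝ) :
    output (prodMass N) (memoryless J) = prodMass fun i => output (N i) J := by
  ext y
  exact expect_prodMass_prod N fun i a => J a (y i)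

theorem expect_joint_prodMass (N : ι → A → ℝ) (J : A → B → ℝ) (f : (ι → A × B) → ℝ) :
    expect (joint (prodMass N) (memoryless J)) (fun xy => f fun i => (xy.1 i, xy.2 i)) =
      expect (prodMass fun i => joint (N i) J) f := by
  refine (Fintype.sum_equiv (Equiv.arrowProdEquivProdArrow ι (fun _ => A) fun _ => B) _ _
    fun z => ?_).symm
  simp only [joint, memoryless, prodMass, Equiv.arrowProdEquivProdArrow,
    Finset.prod_mul_distrib, Equiv.coe_fn_mk]

variable [Nonempty ι]

theorem expect_sampleMean_sub_sq {P : A → ℝ} (hP : P ∈ pmfs A) (f : A → ℝ) :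
    expect (prodMass fun _ : ι => P) (fun x => (expect (uniform ι) (fun i => f (x i)) -
      expect P f) ^ 2) = variance P f / Fintype.card ι := by
  set g : A → ℝ := fun a => f a - expect P f with hg
  have hg0 : expect P g = 0 := by rw [hg, expect_sub, expect_const hP, sub_self]
  have hpair (i j : ι) : expect (prodMass fun _ : ι => P) (fun x => g (x i) * g (x j)) =
      if i = j then variance P f else 0 := by
    split_ifs with h
    · subst h
      rw [expect_prodMass_apply (fun _ => hP) i fun a => g a * g a]
      simp only [variance, hg, sq]
    · rw [expect_prodMass_mul (fun _ => hP) h, hg0, mul_zero]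
  have hsq (x : ι → A) : (expect (uniform ι) (fun i => f (x i)) - expect P f) ^ 2 =
      (∑ i, ∑ j, g (x i) * g (x j)) / (Fintype.card ι : ℝ) ^ 2 := by
    rw [← Finset.sum_mul_sum, ← sq, ← div_pow, ← expect_uniform, hg, expect_sub,
      expect_const uniform_mem_pmfs]
  simp only [hsq, div_eq_mul_inv, expect_mul_const, expect_sum, hpair, Finset.sum_ite_eq,
    Finset.mem_univ, if_true, Finset.sum_const, Finset.card_univ, nsmul_eq_mul]
  field_simp

theorem mass_sampleMean_le {P : A → ℝ} (hP : P ∈ pmfs A) {f : A → ℝ} {γ : ℝ}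
    (hγ : γ < expect P f) :
    mass (prodMass fun _ : ι => P) {x | expect (uniform ι) (fun i => f (x i)) ≤ γ} ≤
      variance P f / (expect P f - γ) ^ 2 / Fintype.card ι := by
  have hd : 0 < expect P f - γ := sub_pos.2 hγ
  have hpmf : prodMass (fun _ : ι => P) ∈ pmfs (ι → A) := prodMass_mem_pmfs fun _ => hP
  rw [div_right_comm, le_div_iff₀' (by positivity), ← expect_sampleMean_sub_sq hP]
  refine le_trans (mul_le_mul_of_nonneg_left (mass_mono hpmf.1 fun x _ hx => ?_) (sq_nonneg _))
    (mul_mass_le_expect hpmf.1 (fun _ => sq_nonneg _) _)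
  simp only [Set.mem_ofPred_eq] at hx ⊢
  rw [sub_sq_comm _ (expect P f)]
  exact pow_le_pow_left₀ hd.le (sub_le_sub_left hx _) 2

end Product

section Types

variable {A : Type*} [Fintype A] {n : ℕ}

theorem expect_seqType (x : Fin n → A) (f : A → ℝ) :
    expect (seqType x) f = expect (uniform (Fin n)) fun i => f (x i) := by
  classical
  have hocc (a : A) : (occ x a : ℝ) = ∑ i, if x i = a then 1 else 0 := by simp [occ]
  rw [expect_uniform, Fintype.card_fin, eq_comm, expect]
  simp only [seqType, div_mul_eq_mul_div, ← Finset.sum_div, hocc, Finset.sum_mul]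
  rw [Finset.sum_comm]
  simp

theorem seqType_eq_expect {A : Type*} (x : Fin n → A) (a : A) :
    seqType x a = expect (uniform (Fin n)) fun i => ({a} : Set A).indicator 1 (x i) := by
  classical
  simp [seqType, occ, expect_uniform, Set.indicator_apply]

theorem seqType_mem_pmfs (hn : 0 < n) (x : Fin n → A) : seqType x ∈ pmfs A := by
  have : NeZero n := ⟨hn.ne'⟩
  refine ⟨fun a => by rw [seqType]; positivity, ?_⟩
  have h : expect (seqType x) (fun _ => 1) = 1 := by
    rw [expect_seqType, expect_const uniform_mem_pmfs]
  simpa only [expect, mul_one] using h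

theorem exists_occ_eq (k : A → ℕ) : ∃ x : Fin (∑ a, k a) → A, ∀ a, occ x a = k a := by
  classical
  let e : Fin (∑ a, k a) ≃ Σ a, Fin (k a) := (Fintype.equivFinOfCardEq (by simp)).symm
  refine ⟨fun i => (e i).1, fun a => ?_⟩
  calc occ (fun i => (e i).1) a = Fintype.card {i // (e i).1 = a} := by
        rw [Fintype.card_subtype, occ]
    _ = Fintype.card {t : Σ a, Fin (k a) // t.1 = a} :=
        Fintype.card_congr (e.subtypeEquiv fun _ => Iff.rfl)
    _ = k a := (Fintype.card_congr (Equiv.sigmaSubtype a)).trans (Fintype.card_fin _)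

theorem exists_common_denominator {A : Type*} [Finite A] {P : A → ℝ} (h0 : ∀ a, 0 ≤ P a)
    (hP : ∀ a, P a ∈ (Rat.castHom ℝ).fieldRange) :
    ∃ d : ℕ, 0 < d ∧ ∃ k : A → ℕ, ∀ a, (k a : ℝ) = P a * d := by
  cases nonempty_fintype A
  have hq (a : A) : ∃ q : ℚ≥0, (q : ℝ) = P a := by
    obtain ⟨r, hr⟩ := hP a
    exact ⟨⟨r, Rat.cast_nonneg.1 ((h0 a).trans_eq hr.symm)⟩, hr⟩
  choose q hq using hq
  refine ⟨∏ a, (q a).den, Finset.prod_pos fun a _ => (q a).den_pos, ?_⟩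
  choose e he using fun a => Finset.dvd_prod_of_mem (fun a => (q a).den) (Finset.mem_univ a)
  refine ⟨fun a => (q a).num * e a, fun a => ?_⟩
  rw [he a, ← hq a, Nat.cast_mul, Nat.cast_mul, ← mul_assoc]
  exact_mod_cast congrArg (fun t : ℚ≥0 => (t : ℝ) * e a) (NNRat.mul_den_eq_num (q a)).symm

theorem mem_types_iff {P : A → ℝ} :
    P ∈ types A ↔ P ∈ pmfs A ∧ ∀ a, P a ∈ (Rat.castHom ℝ).fieldRange := by
  constructor
  · rintro ⟨n, hn, x, rfl⟩
    exact ⟨seqType_mem_pmfs hn x, fun a => div_mem (natCast_mem _ _) (natCast_mem _ _)⟩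
  · rintro ⟨hP, hrat⟩
    obtain ⟨d, hd, k, hk⟩ := exists_common_denominator hP.1 hrat
    obtain ⟨x, hx⟩ := exists_occ_eq k
    have hd' : (d : ℝ) ≠ 0 := Nat.cast_ne_zero.2 hd.ne'
    have hsum : ((∑ a, k a : ℕ) : ℝ) = d := by
      rw [Nat.cast_sum, Finset.sum_congr rfl fun a _ => hk a, ← Finset.sum_mul, hP.2, one_mul]
    refine ⟨∑ a, k a, (Nat.cast_injective hsum).symm ▸ hd, x, funext fun a => ?_⟩
    rw [seqType, hx, hsum, hk, mul_div_cancel_right₀ _ hd']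

theorem variance_indicator_le_one {P : A → ℝ} (hP : P ∈ pmfs A) (E : Set A) :
    variance P (E.indicator 1) ≤ 1 := by
  rw [← expect_const hP 1]
  refine expect_mono hP.1 fun a _ => (sq_le_one_iff_abs_le_one _).2 (abs_le.2 ?_)
  have h0 : 0 ≤ expect P (E.indicator 1) := mass_nonneg hP.1 E
  have h1 : expect P (E.indicator 1) ≤ 1 := mass_le_one hP E
  by_cases ha : a ∈ E <;> simp only [ha, Set.indicator_of_mem, Set.indicator_of_notMem,
    not_false_iff, Pi.one_apply] <;> constructor <;> linarith

theorem expect_variational_sq_le [NeZero n] {P : A → ℝ} (hP : P ∈ pmfs A) :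
    expect (prodMass fun _ : Fin n => P) (fun x => variational P (seqType x) ^ 2) ≤
      (Fintype.card A : ℝ) ^ 2 / n := by
  have hpmf : prodMass (fun _ : Fin n => P) ∈ pmfs (Fin n → A) := prodMass_mem_pmfs fun _ => hP
  have hsymbol (a : A) : expect (prodMass fun _ : Fin n => P)
      (fun x => (P a - seqType x a) ^ 2) ≤ 1 / n := by
    have h := expect_sampleMean_sub_sq (ι := Fin n) hP (({a} : Set A).indicator 1)
    rw [Fintype.card_fin] at h
    simp only [seqType_eq_expect, sub_sq_comm (P a)]
    rw [← mass_singleton P a]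
    refine h.trans_le ?_
    gcongr
    exact variance_indicator_le_one hP _
  calc expect (prodMass fun _ : Fin n => P) (fun x => variational P (seqType x) ^ 2)
      ≤ expect (prodMass fun _ : Fin n => P)
          (fun x => Fintype.card A * ∑ a, (P a - seqType x a) ^ 2) :=
        expect_mono hpmf.1 fun x _ => by
          simpa only [sq_abs, variational, Finset.card_univ] using
            sq_sum_le_card_mul_sum_sq (s := Finset.univ) (f := fun a => |P a - seqType x a|)
    _ = Fintype.card A * ∑ a, expect (prodMass fun _ : Fin n => P)
          (fun x => (P a - seqType x a) ^ 2) := by rw [expect_const_mul, expect_sum]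
    _ ≤ Fintype.card A * ∑ _a : A, (1 / n : ℝ) := by
        gcongr with a; exact hsymbol a
    _ = (Fintype.card A : ℝ) ^ 2 / n := by
        rw [Finset.sum_const, Finset.card_univ, nsmul_eq_mul]; ring

end Types

section Information

variable {ι A B : Type*} [Fintype ι] [Fintype A] [Fintype B]

/-- The entropy, in bits, of a mass function. -/
def entropy (P : A → ℝ) : ℝ := expect P fun a => -Real.logb 2 (P a)

/-- The Kullback–Leibler divergence of `P` from `Q`, in bits. It is meaningful only if `Q` is
positive wherever `P` is: other symbols contribute `0` here, not `∞`. -/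
def divergence (P Q : A → ℝ) : ℝ := expect P fun a => Real.logb 2 (P a / Q a)

/-- The information density, in bits, of an input and an output symbol of the channel `J` with
input distribution `N`; its mean is the mutual information. -/
def infoDensity (N : A → ℝ) (J : A → B → ℝ) : A × B → ℝ :=
  fun ab => Real.logb 2 (J ab.1 ab.2 / output N J ab.2)

theorem continuous_entropy : Continuous (entropy : (A → ℝ) → ℝ) := by
  have h : (entropy : (A → ℝ) → ℝ) = fun P => (∑ a, Real.negMulLog (P a)) / Real.log 2 := by
    ext P
    simp only [entropy, expect, Real.logb, Real.negMulLog, Finset.sum_div]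
    exact Finset.sum_congr rfl fun a _ => by ring
  rw [h]
  exact (continuous_finsetSum _ fun a _ =>
    Real.continuous_negMulLog.comp (continuous_apply a)).div_const _

theorem divergence_nonneg {P Q : A → ℝ} (hP : P ∈ pmfs A) (hQ : Q ∈ pmfs A)
    (h : ∀ a, 0 < P a → 0 < Q a) : 0 ≤ divergence P Q := by
  have hlog : 0 < Real.log 2 := Real.log_pos one_lt_two
  have hsum : expect P (fun a => Q a / P a) ≤ 1 := by
    rw [← hQ.2]
    refine Finset.sum_le_sum fun a _ => ?_
    by_cases ha : P a = 0
    · simpa only [ha, zero_mul] using hQ.1 a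
    · exact (mul_div_cancel₀ _ ha).le
  calc 0 ≤ (1 - expect P fun a => Q a / P a) / Real.log 2 :=
        div_nonneg (sub_nonneg.2 hsum) hlog.le
    _ = expect P fun a => (1 - Q a / P a) / Real.log 2 := by
        simp only [div_eq_mul_inv _ (Real.log 2), expect_mul_const, expect_sub, expect_const hP]
    _ ≤ divergence P Q := expect_mono hP.1 fun a ha => by
        rw [Real.logb]
        gcongr
        simpa only [inv_div] using Real.one_sub_inv_le_log_of_pos (div_pos ha (h a ha))

theorem mutualInfo_joint_eq_expect_infoDensity (N : A → ℝ) {J : A → B → ℝ} (hJ : IsChannel J) :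
    mutualInfo (joint N J) = expect (joint N J) (infoDensity N J) := by
  rw [mutualInfo, expect, Fintype.sum_prod_type]
  refine Finset.sum_congr rfl fun a _ => Finset.sum_congr rfl fun b _ => ?_
  have hrow : ∑ b', joint N J (a, b') = N a := by
    simp only [joint, ← Finset.mul_sum, (hJ a).2, mul_one]
  rw [hrow]
  by_cases h : N a = 0
  · simp only [joint, h, zero_mul]
  · rw [joint, mul_div_mul_left _ _ h]
    rfl

theorem mutualInfo_joint_eq_expect_divergence (N : A → ℝ) {J : A → B → ℝ} (hJ : IsChannel J) :
    mutualInfo (joint N J) = expect N fun a => divergence (J a) (output N J) := by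
  rw [mutualInfo_joint_eq_expect_infoDensity N hJ, expect_joint]
  rfl

theorem mutualInfo_joint_eq_entropy_sub {N : A → ℝ} (hN : ∀ a, 0 ≤ N a) {J : A → B → ℝ}
    (hJ : IsChannel J) :
    mutualInfo (joint N J) = entropy (output N J) - expect N fun a => entropy (J a) := by
  rw [mutualInfo_joint_eq_expect_divergence N hJ, entropy, expect_output, ← expect_sub]
  refine expect_congr hN fun a ha => ?_
  rw [entropy, ← expect_sub]
  refine expect_congr (hJ a).1 fun b hb => ?_
  rw [Real.logb_div hb.ne' (output_pos hN hJ ha hb).ne']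
  ring

theorem continuous_output {B : Type*} (J : A → B → ℝ) :
    Continuous fun N : A → ℝ => output N J := by
  unfold output; fun_prop

theorem continuousOn_mutualInfo {J : A → B → ℝ} (hJ : IsChannel J) :
    ContinuousOn (fun N : A → ℝ => mutualInfo (joint N J)) (pmfs A) := by
  refine ContinuousOn.congr (Continuous.continuousOn ?_)
    fun N hN => mutualInfo_joint_eq_entropy_sub hN.1 hJ
  refine (continuous_entropy.comp (continuous_output J)).sub ?_
  unfold expect; fun_prop

theorem logb_prodMass_div {B : Type*} {W V : ι → B → ℝ} {y : ι → B} (hW : ∀ i, 0 < W i (y i))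
    (hV : ∀ i, 0 < V i (y i)) :
    Real.logb 2 (prodMass W y / prodMass V y) = ∑ i, Real.logb 2 (W i (y i) / V i (y i)) := by
  rw [prodMass, prodMass, ← Finset.prod_div_distrib,
    Real.logb_prod _ _ fun i _ => (div_pos (hW i) (hV i)).ne']

theorem divergence_prodMass [DecidableEq ι] {W V : ι → B → ℝ} (hW : ∀ i, W i ∈ pmfs B)
    (hV : ∀ i b, 0 < W i b → 0 < V i b) :
    divergence (prodMass W) (prodMass V) = ∑ i, divergence (W i) (V i) := by
  have hdens : divergence (prodMass W) (prodMass V) =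
      expect (prodMass W) fun y => ∑ i, Real.logb 2 (W i (y i) / V i (y i)) :=
    expect_congr (prodMass_mem_pmfs hW).1 fun y hy =>
      have hWy := prodMass_pos (fun i => (hW i).1) hy
      logb_prodMass_div hWy fun i => hV i _ (hWy i)
  rw [hdens, expect_sum]
  exact Finset.sum_congr rfl fun i _ =>
    expect_prodMass_apply hW i fun b => Real.logb 2 (W i b / V i b)

end Information

section Density

variable {A B S : Type*} [Fintype A]

/-- The additive maps from `ℝ` to `ℚ`, viewed as real functions. They preserve linear equations with
rational coefficients, and serve to approximate a real solution by rational ones. -/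
def rationalLinearMaps : Set (ℝ → ℝ) := Set.range fun (φ : ℝ →ₗ[ℚ] ℚ) (r : ℝ) => (φ r : ℝ)

-- A map is obtained by moving the elements of a Hamel basis to nearby rationals.
theorem id_mem_closure_rationalLinearMaps : (id : ℝ → ℝ) ∈ closure rationalLinearMaps := by
  let ι := Module.Basis.ofVectorSpaceIndex ℚ ℝ
  let b : Module.Basis ι ℚ ℝ := Module.Basis.ofVectorSpace ℚ ℝ
  let extend (f : ι → ℝ) (r : ℝ) : ℝ :=
    (b.repr r).sum fun i q => (q : ℝ) * f i
  have hcont : Continuous extend :=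
    continuous_pi fun r => continuous_finsetSum _ fun i _ =>
      continuous_const.mul (continuous_apply i)
  have hdense : DenseRange (Pi.map fun (_ : ι) (q : ℚ) => (q : ℝ)) :=
    DenseRange.piMap fun _ => Rat.denseRange_cast
  have hid : extend (fun i => b i) = id := funext fun r => by
    conv_rhs => rw [id, ← b.linearCombination_repr r, Finsupp.linearCombination_apply]
    simp only [extend, Rat.smul_def]
  rw [← hid]
  refine map_mem_closure hcont (hdense fun i => b i) ?_
  rintro _ ⟨q, rfl⟩
  refine ⟨b.constr ℚ q, funext fun r => ?_⟩
  simp only [extend, Module.Basis.constr_apply, Finsupp.sum, Pi.map_apply, smul_eq_mul,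
    Rat.cast_sum, Rat.cast_mul]

theorem map_mul_of_mem_fieldRange (φ : ℝ →ₗ[ℚ] ℚ) (r : ℝ) {t : ℝ}
    (ht : t ∈ (Rat.castHom ℝ).fieldRange) : (φ (r * t) : ℝ) = φ r * t := by
  obtain ⟨q, rfl⟩ := ht
  rw [Rat.coe_castHom, mul_comm, ← Rat.smul_def, map_smul, smul_eq_mul, Rat.cast_mul, mul_comm]

theorem div_map_one_mem_preimage {N : A → ℝ} (hN : ∑ a, N a = 1) {K : A → B → ℝ}
    (hK : ∀ a b, K a b ∈ (Rat.castHom ℝ).fieldRange)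
    (hNK : ∀ b, output N K b ∈ (Rat.castHom ℝ).fieldRange) {φ : ℝ →ₗ[ℚ] ℚ} (h1 : 0 < φ 1)
    (hpos : ∀ a, 0 ≤ φ (N a)) :
    (fun a => (φ (N a) / φ 1 : ℝ)) ∈ preimage (output N K) K := by
  have h1' : (φ 1 : ℝ) ≠ 0 := Rat.cast_ne_zero.2 h1.ne'
  refine ⟨mem_types_iff.2 ⟨⟨fun a => ?_, ?_⟩, fun a => ⟨φ (N a) / φ 1, Rat.cast_div _ _⟩⟩, ?_⟩
  · exact div_nonneg (Rat.cast_nonneg.2 (hpos a)) (Rat.cast_nonneg.2 h1.le)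
  · rw [← Finset.sum_div, ← Rat.cast_sum, ← map_sum, hN, div_self h1']
  · ext b
    calc ∑ a, (φ (N a) / φ 1 : ℝ) * K a b = φ (output N K b) / φ 1 := by
          simp only [output, map_sum, Rat.cast_sum, map_mul_of_mem_fieldRange φ _ (hK _ b),
            Finset.sum_div, div_mul_eq_mul_div]
      _ = output N K b := by
          rw [← one_mul (output N K b), map_mul_of_mem_fieldRange φ 1 (hNK b),
            mul_div_cancel_left₀ _ h1', one_mul]

theorem mem_closure_iInter_preimage {N : A → ℝ} (hN : N ∈ pmfs A) {K : S → A → B → ℝ}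
    (hK : ∀ s a b, K s a b ∈ (Rat.castHom ℝ).fieldRange)
    (hNK : ∀ s b, output N (K s) b ∈ (Rat.castHom ℝ).fieldRange) :
    N ∈ closure (⋂ s, preimage (output N (K s)) (K s)) := by
  have htendsto : Tendsto (fun (f : ℝ → ℝ) a => f (N a) / f 1) (𝓝 id) (𝓝 N) := by
    have h : Tendsto (fun (f : ℝ → ℝ) a => f (N a) / f 1) (𝓝 id) (𝓝 fun a => N a / 1) :=
      tendsto_pi_nhds.2 fun a => ((continuous_apply (N a)).tendsto id).div
        ((continuous_apply (1 : ℝ)).tendsto id) one_ne_zero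
    simpa only [div_one] using h
  have hpos (r : ℝ) (hr : 0 < r) : ∀ᶠ f : ℝ → ℝ in 𝓝 id, 0 < f r :=
    ((continuous_apply r).tendsto (id : ℝ → ℝ)).eventually_const_lt hr
  have hposN : ∀ᶠ f : ℝ → ℝ in 𝓝 id, ∀ a, 0 < N a → 0 < f (N a) :=
    eventually_all.2 fun a => eventually_imp_distrib_left.2 (hpos (N a))
  refine mem_closure_iff_frequently.2 (htendsto.frequently
    ((mem_closure_iff_frequently.1 id_mem_closure_rationalLinearMaps).mp ?_))
  filter_upwards [hpos 1 one_pos, hposN] with f h1 hfN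
  rintro ⟨φ, rfl⟩
  refine Set.mem_iInter.2 fun s => div_map_one_mem_preimage hN.2 (hK s) (hNK s)
    (Rat.cast_pos.1 h1) fun a => ?_
  rcases (hN.1 a).eq_or_lt with h | h
  · rw [← h, map_zero]
  · exact (Rat.cast_pos.1 (hfN a h)).le

end Density

section Channel

variable {X Y Z S : Type*} [Fintype Y] {p : X × S → Y × Z → ℝ}

theorem sum_occ_pair {A B : Type*} [Fintype B] {n : ℕ} (x : Fin n → A) (y : Fin n → B) (a : A) :
    ∑ b, occ (fun i => (x i, y i)) (a, b) = occ x a := by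
  classical
  rw [occ, Finset.card_eq_sum_card_fiberwise (f := y) (t := Finset.univ) fun _ _ => by simp]
  simp only [occ, Finset.filter_filter, Prod.mk.injEq]

theorem isChannel_of_mem_condTypes {A B : Type*} [Fintype B] {J : A → B → ℝ}
    (h : J ∈ condTypes A B) : IsChannel J := by
  obtain ⟨n, -, x, y, hx, hJ⟩ := h
  refine fun a => ⟨fun b => by rw [hJ]; positivity, ?_⟩
  simp only [hJ]
  rw [← Finset.sum_div, ← Nat.cast_sum, sum_occ_pair, div_self (Nat.cast_ne_zero.2 (hx a).ne')]

theorem mem_fieldRange_of_mem_condTypes {A B : Type*} {J : A → B → ℝ} (h : J ∈ condTypes A B)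
    (a : A) (b : B) : J a b ∈ (Rat.castHom ℝ).fieldRange := by
  obtain ⟨n, -, x, y, -, hJ⟩ := h
  exact hJ a b ▸ div_mem (natCast_mem _ _) (natCast_mem _ _)

theorem isChannel_chanY [Fintype Z] (hp : IsChannel p) (s : S) : IsChannel (chanY p s) := fun a =>
  ⟨fun b => Finset.sum_nonneg fun c _ => (hp _).1 _, by
    simp only [chanY, ← Fintype.sum_prod_type', (hp _).2]⟩

theorem isChannel_chanZ [Fintype Z] (hp : IsChannel p) (s : S) : IsChannel (chanZ p s) := fun a =>
  ⟨fun c => Finset.sum_nonneg fun b _ => (hp _).1 _, by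
    simp only [chanZ, ← Fintype.sum_prod_type_right', (hp _).2]⟩

variable [Fintype X]

/-- The PMFs on the input alphabet that produce the output distribution `Q s` at the observer in
every state `s`; `commonPreimage p Q` consists of the types among them. -/
def admissibleInputs (p : X × S → Y × Z → ℝ) (Q : S → Z → ℝ) : Set (X → ℝ) :=
  {N | N ∈ pmfs X ∧ ∀ s, output N (chanZ p s) = Q s}

theorem commonPreimage_subset_admissibleInputs [Nonempty S] (Q : S → Z → ℝ) :
    commonPreimage p Q ⊆ admissibleInputs p Q := fun _ hN =>
  ⟨(mem_types_iff.1 (Set.mem_iInter.1 hN (Classical.arbitrary S)).1).1,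
    fun s => (Set.mem_iInter.1 hN s).2⟩

theorem isCompact_pmfs : IsCompact (pmfs X) := isCompact_stdSimplex ℝ X

theorem isCompact_admissibleInputs (Q : S → Z → ℝ) : IsCompact (admissibleInputs p Q) := by
  have h : admissibleInputs p Q = pmfs X ∩ ⋂ s, {N | output N (chanZ p s) = Q s} := by
    ext; simp [admissibleInputs]
  rw [h]
  exact isCompact_pmfs.inter_right
    (isClosed_iInter fun s => isClosed_eq (continuous_output _) continuous_const)

theorem admissibleInputs_subset_closure [Finite Z]
    (hK : ∀ s a k, chanZ p s a k ∈ (Rat.castHom ℝ).fieldRange) {Q : S → Z → ℝ}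
    (hQ : ∀ s, Q s ∈ types Z) : admissibleInputs p Q ⊆ closure (commonPreimage p Q) := by
  cases nonempty_fintype Z
  rintro N ⟨hN, hNQ⟩
  obtain rfl : (fun s => output N (chanZ p s)) = Q := funext hNQ
  exact mem_closure_iInter_preimage hN hK fun s => (mem_types_iff.1 (hQ s)).2

variable [Fintype Z] [Finite S]

theorem minInfo_le (N : X → ℝ) (s : S) : minInfo p N ≤ mutualInfo (joint N (chanY p s)) :=
  ciInf_le (Set.finite_range _).bddBelow s

variable [Nonempty S]

theorem continuousOn_minInfo (hp : IsChannel p) : ContinuousOn (minInfo p) (pmfs X) := by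
  cases nonempty_fintype S
  have h : minInfo p = fun N => Finset.univ.inf' Finset.univ_nonempty
      fun s => mutualInfo (joint N (chanY p s)) :=
    funext fun N => (Finset.inf'_univ_eq_ciInf _).symm
  rw [h]
  exact ContinuousOn.finset_inf'_apply _ fun s _ => continuousOn_mutualInfo (isChannel_chanY hp s)

theorem exists_isLUB_isGreatest_minInfo (hp : IsChannel p)
    (hK : ∀ s a k, chanZ p s a k ∈ (Rat.castHom ℝ).fieldRange) {Q : S → Z → ℝ}
    (hQ : ∀ s, Q s ∈ types Z) (hne : (commonPreimage p Q).Nonempty) :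
    ∃ v : ℝ, IsLUB (minInfo p '' commonPreimage p Q) v ∧
      IsGreatest (minInfo p '' admissibleInputs p Q) v := by
  have hsub : commonPreimage p Q ⊆ admissibleInputs p Q := commonPreimage_subset_admissibleInputs Q
  have hcont : ContinuousOn (minInfo p) (admissibleInputs p Q) :=
    (continuousOn_minInfo hp).mono fun N hN => hN.1
  obtain ⟨N, hN, hmax⟩ := (isCompact_admissibleInputs Q).exists_isMaxOn (hne.mono hsub) hcont
  have hmax' : minInfo p N ∈ upperBounds (minInfo p '' admissibleInputs p Q) :=
    Set.forall_mem_image.2 hmax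
  refine ⟨minInfo p N, ⟨upperBounds_mono_set (Set.image_mono hsub) hmax', fun u hu => ?_⟩,
    Set.mem_image_of_mem _ hN, hmax'⟩
  have hmem : minInfo p N ∈ closure (minInfo p '' commonPreimage p Q) :=
    ((hcont N hN).mono hsub).mem_closure_image (admissibleInputs_subset_closure hK hQ hN)
  exact closure_minimal hu isClosed_Iic hmem

end Channel

section Code

variable {X Y Z S : Type*} [Fintype Y] [Fintype Z] {M n : ℕ}

/-- The error probability of a code over the memoryless channel `J`, for a uniform message. -/
def Code.errorProb (c : Code X Y M n) (J : X → Y → ℝ) : ℝ :=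
  expect (uniform (Fin M)) fun m => mass (memoryless J (c.enc m)) {y | c.dec y ≠ m}

/-- The distribution of the output sequence of the memoryless channel `K` when a uniform message
is sent. -/
def Code.blockOutput (c : Code X Y M n) (K : X → Z → ℝ) : (Fin n → Z) → ℝ :=
  output (uniform (Fin M)) fun m => memoryless K (c.enc m)

/-- The average of the types of the codewords. -/
def Code.meanType (c : Code X Y M n) : X → ℝ :=
  output (uniform (Fin M)) fun m => seqType (c.enc m)

theorem prob_dec_ne (p : X × S → Y × Z → ℝ) (s : S) (c : Code X Y M n) :
    prob p s c (fun m y _ => c.dec y ≠ m) = c.errorProb (chanY p s) := by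
  classical
  rw [prob, Code.errorProb, expect_uniform, Fintype.card_fin]
  congr 1
  refine Finset.sum_congr rfl fun m _ => Finset.sum_congr rfl fun y _ => ?_
  by_cases h : c.dec y = m
  · simp [h]
  · simp [h, memoryless, prodMass, chanY, Fintype.prod_sum]

theorem prob_interference (p : X × S → Y × Z → ℝ) (s : S) (c : Code X Y M n)
    (D : Set (Fin n → Z)) :
    prob p s c (fun _ _ z => z ∈ D) = mass (c.blockOutput (chanZ p s)) D := by
  classical
  rw [prob, Code.blockOutput, mass, expect_output, expect_uniform, Fintype.card_fin]
  congr 1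
  refine Finset.sum_congr rfl fun m _ => ?_
  rw [Finset.sum_comm]
  refine Finset.sum_congr rfl fun z _ => ?_
  by_cases h : z ∈ D
  · simp [h, memoryless, prodMass, chanZ, Fintype.prod_sum]
  · simp [h]

theorem Code.errorProb_nonneg (c : Code X Y M n) {J : X → Y → ℝ} (hJ : IsChannel J) :
    0 ≤ c.errorProb J :=
  expect_nonneg (fun _ => by rw [uniform]; positivity) fun _ =>
    mass_nonneg (isChannel_memoryless hJ _).1 _

theorem Code.blockOutput_mem_pmfs {Y : Type*} [NeZero M] (c : Code X Y M n) {K : X → Z → ℝ}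
    (hK : IsChannel K) : c.blockOutput K ∈ pmfs (Fin n → Z) :=
  output_mem_pmfs uniform_mem_pmfs fun _ => isChannel_memoryless hK _

end Code

section RandomCoding

variable {ι A B S : Type*} [Fintype A] [Fintype B]

/-- The likelihood-ratio test of threshold `Γ` between the channel `W` and its output distribution
under `P`. Where the output distribution vanishes the quotient is `0`, so that the test fails. -/
def ratioTest (P : A → ℝ) (W : A → B → ℝ) (Γ : ℝ) (x : A) (y : B) : Prop :=
  Γ ≤ W x y / output P W y

/-- The decoder that returns some message whose codeword passes the test `T` against the channel
output; the message is arbitrary if there is none. -/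
def testDecoder {A B : Type*} [Nonempty ι] (T : A → B → Prop) (e : ι → A) (y : B) : ι :=
  Classical.epsilon fun m => T (e m) y

theorem mass_ratioTest_le {B : Type*} {P : A → ℝ} (hP : ∀ a, 0 ≤ P a) {W : A → B → ℝ}
    (hW : ∀ a b, 0 ≤ W a b) {Γ : ℝ} (hΓ : 0 < Γ) (y : B) :
    mass P {x | ratioTest P W Γ x y} ≤ 1 / Γ := by
  have hout : 0 ≤ output P W y := expect_nonneg hP fun a => hW a y
  rw [le_div_iff₀' hΓ]
  calc Γ * mass P {x | ratioTest P W Γ x y} ≤ expect P fun x => W x y / output P W y :=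
        mul_mass_le_expect hP (fun x => div_nonneg (hW x y) hout) Γ
    _ = output P W y / output P W y := by
        simp only [div_eq_mul_inv, expect_mul_const]
        rfl
    _ ≤ 1 := div_self_le_one _

theorem not_test_or_exists_of_testDecoder_ne {A B : Type*} [Nonempty ι] {T : A → B → Prop}
    {e : ι → A} {y : B} {m : ι} (h : testDecoder T e y ≠ m) :
    ¬T (e m) y ∨ ∃ m' : {m' // m' ≠ m}, T (e m') y := by
  refine or_iff_not_imp_left.2 fun hm => ⟨⟨_, h⟩, ?_⟩
  exact Classical.epsilon_spec (p := fun m' => T (e m') y) ⟨m, not_not.1 hm⟩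

variable [Fintype ι] [DecidableEq ι]

-- The codewords of distinct messages are independent, so the output caused by one of them is
-- independent of the other.
theorem expect_mass_other_codeword {P : A → ℝ} (hP : P ∈ pmfs A) (W : A → B → ℝ)
    (T : A → B → Prop) {m m' : ι} (h : m' ≠ m) :
    expect (prodMass fun _ : ι => P) (fun e => mass (W (e m)) {y | T (e m') y}) =
      expect (output P W) fun y => mass P {x | T x y} := by
  calc expect (prodMass fun _ : ι => P) (fun e => mass (W (e m)) {y | T (e m') y})
      = ∑ y, expect (prodMass fun _ : ι => P)
          fun e => W (e m) y * {x | T x y}.indicator 1 (e m') := expect_sum _ _ _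
    _ = ∑ y, output P W y * mass P {x | T x y} := Finset.sum_congr rfl fun y _ =>
        expect_prodMass_mul (fun _ => hP) h.symm (fun x => W x y) _

theorem expect_mass_testDecoder_ne_le [Nonempty ι] {P : A → ℝ} (hP : P ∈ pmfs A)
    {W : A → B → ℝ} (hW : IsChannel W) {T : A → B → Prop} {δ : ℝ}
    (hT : ∀ y, mass P {x | T x y} ≤ δ) (m : ι) :
    expect (prodMass fun _ : ι => P) (fun e => mass (W (e m)) {y | testDecoder T e y ≠ m}) ≤
      expect P (fun x => mass (W x) {y | ¬T x y}) + (Fintype.card ι - 1) * δ := by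
  have hpmf : prodMass (fun _ : ι => P) ∈ pmfs (ι → A) := prodMass_mem_pmfs fun _ => hP
  have hother (m' : {m' // m' ≠ m}) :
      expect (prodMass fun _ : ι => P) (fun e => mass (W (e m)) {y | T (e m') y}) ≤ δ := by
    rw [expect_mass_other_codeword hP W T m'.2]
    exact (expect_mono (output_mem_pmfs hP hW).1 fun y _ => hT y).trans_eq
      (expect_const (output_mem_pmfs hP hW) δ)
  calc expect (prodMass fun _ : ι => P) (fun e => mass (W (e m)) {y | testDecoder T e y ≠ m})
      ≤ expect (prodMass fun _ : ι => P) (fun e => mass (W (e m)) {y | ¬T (e m) y} +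
          ∑ m' : {m' // m' ≠ m}, mass (W (e m)) {y | T (e m') y}) :=
        expect_mono hpmf.1 fun e _ =>
          (mass_mono (hW _).1 fun y _ hy => (not_test_or_exists_of_testDecoder_ne hy).imp id
            Set.mem_iUnion.2).trans ((mass_union_le (hW _).1 _ _).trans
              (add_le_add_right (mass_iUnion_le (hW _).1 _) _))
    _ = expect P (fun x => mass (W x) {y | ¬T x y}) + ∑ m' : {m' // m' ≠ m},
          expect (prodMass fun _ : ι => P) (fun e => mass (W (e m)) {y | T (e m') y}) := by
        rw [expect_add, expect_sum,
          expect_prodMass_apply (fun _ => hP) m fun x => mass (W x) {y | ¬T x y}]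
    _ ≤ expect P (fun x => mass (W x) {y | ¬T x y}) + ∑ _m' : {m' // m' ≠ m}, δ := by
        gcongr with m' _
        exact hother m'
    _ = expect P (fun x => mass (W x) {y | ¬T x y}) + (Fintype.card ι - 1) * δ := by
        have hcard : 1 ≤ Fintype.card ι := Fintype.card_pos
        simp [Fintype.card_subtype_compl, Nat.cast_sub hcard]

end RandomCoding

section RandomCode

variable {X Y Z S : Type*} [Fintype X] [Fintype Y] [Fintype Z] [Fintype S] {M n : ℕ}

theorem sampleMean_infoDensity_le_of_not_ratioTest [NeZero n] {N : X → ℝ} (hN : ∀ a, 0 ≤ N a)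
    {J : X → Y → ℝ} (hJ : IsChannel J) {γ : ℝ} {z : Fin n → X × Y}
    (hz : 0 < prodMass (fun _ => joint N J) z)
    (h : ¬ratioTest (prodMass fun _ => N) (memoryless J) (2 ^ (n * γ)) (fun i => (z i).1)
      fun i => (z i).2) :
    expect (uniform (Fin n)) (fun i => infoDensity N J (z i)) ≤ γ := by
  have hpos (i : Fin n) : 0 < joint N J (z i) :=
    prodMass_pos (fun _ _ => mul_nonneg (hN _) ((hJ _).1 _)) hz i
  have hJpos (i : Fin n) : 0 < J (z i).1 (z i).2 := pos_of_mul_pos_right (hpos i) (hN _)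
  have hout (i : Fin n) : 0 < output N J (z i).2 :=
    output_pos hN hJ (pos_of_mul_pos_left (hpos i) ((hJ _).1 _)) (hJpos i)
  have hratio : 0 < prodMass (fun i => J (z i).1) (fun i => (z i).2) /
      prodMass (fun _ => output N J) fun i => (z i).2 :=
    div_pos (Finset.prod_pos fun i _ => hJpos i) (Finset.prod_pos fun i _ => hout i)
  rw [ratioTest, output_prodMass, not_le, memoryless,
    ← Real.logb_lt_iff_lt_rpow one_lt_two hratio, logb_prodMass_div hJpos hout] at h
  rw [expect_uniform, Fintype.card_fin, div_le_iff₀' (Nat.cast_pos.2 (NeZero.pos n))]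
  exact h.le

theorem expect_mass_not_ratioTest_le [NeZero n] {N : X → ℝ} (hN : N ∈ pmfs X) {J : X → Y → ℝ}
    (hJ : IsChannel J) {γ : ℝ} (hγ : γ < mutualInfo (joint N J)) :
    expect (prodMass fun _ : Fin n => N) (fun x => mass (memoryless J x)
      {y | ¬ratioTest (prodMass fun _ => N) (memoryless J) (2 ^ (n * γ)) x y}) ≤
      variance (joint N J) (infoDensity N J) / (mutualInfo (joint N J) - γ) ^ 2 / n := by
  have hjoint : joint N J ∈ pmfs (X × Y) := joint_mem_pmfs hN hJ
  calc expect (prodMass fun _ : Fin n => N) (fun x => mass (memoryless J x)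
        {y | ¬ratioTest (prodMass fun _ => N) (memoryless J) (2 ^ (n * γ)) x y})
      = mass (prodMass fun _ : Fin n => joint N J)
          {z | ¬ratioTest (prodMass fun _ => N) (memoryless J) (2 ^ (n * γ)) (fun i => (z i).1)
            fun i => (z i).2} := by
        rw [mass, ← expect_joint_prodMass, expect_joint]
        rfl
    _ ≤ mass (prodMass fun _ : Fin n => joint N J)
          {z | expect (uniform (Fin n)) (fun i => infoDensity N J (z i)) ≤ γ} :=
        mass_mono (prodMass_mem_pmfs fun _ => hjoint).1 fun z hz h =>
          sampleMean_infoDensity_le_of_not_ratioTest hN.1 hJ hz h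
    _ ≤ _ := by
        rw [mutualInfo_joint_eq_expect_infoDensity N hJ] at hγ ⊢
        simpa only [Fintype.card_fin] using mass_sampleMean_le (ι := Fin n) hjoint hγ

/-- The code with codebook `e` whose decoder looks for a codeword that passes the likelihood-ratio
test, at rate `γ` and for codewords drawn from `N`, of at least one of the channels `J s`. -/
def Code.ofCodebook [NeZero M] (N : X → ℝ) (J : S → X → Y → ℝ) (γ : ℝ) (e : Fin M → Fin n → X) :
    Code X Y M n where
  enc := e
  dec := testDecoder
    (fun x y => ∃ s, ratioTest (prodMass fun _ => N) (memoryless (J s)) (2 ^ (n * γ)) x y) e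

/-- The mean square variational distance between `Q` and the type of the output sequence of the
channel `K`. -/
def Code.deviation (c : Code X Y M n) (K : X → Z → ℝ) (Q : Z → ℝ) : ℝ :=
  expect (c.blockOutput K) fun z => variational Q (seqType z) ^ 2

theorem Code.deviation_nonneg {X Y : Type*} [NeZero M] (c : Code X Y M n) {K : X → Z → ℝ}
    (hK : IsChannel K) (Q : Z → ℝ) : 0 ≤ c.deviation K Q :=
  expect_nonneg (c.blockOutput_mem_pmfs hK).1 fun _ => sq_nonneg _

theorem expect_errorProb_ofCodebook_le [NeZero M] [NeZero n] {N : X → ℝ} (hN : N ∈ pmfs X)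
    {J : S → X → Y → ℝ} (hJ : ∀ s, IsChannel (J s)) {γ : ℝ} {s : S}
    (hγ : γ < mutualInfo (joint N (J s))) :
    expect (prodMass fun _ : Fin M => prodMass fun _ : Fin n => N)
        (fun e => (Code.ofCodebook N J γ e).errorProb (J s)) ≤
      variance (joint N (J s)) (infoDensity N (J s)) / (mutualInfo (joint N (J s)) - γ) ^ 2 / n +
        (M - 1) * (Fintype.card S / 2 ^ (n * γ)) := by
  set P : (Fin n → X) → ℝ := prodMass fun _ => N
  have hP : P ∈ pmfs (Fin n → X) := prodMass_mem_pmfs fun _ => hN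
  set T : (Fin n → X) → (Fin n → Y) → Prop :=
    fun x y => ∃ s, ratioTest P (memoryless (J s)) (2 ^ (n * γ)) x y
  have hT (y : Fin n → Y) : mass P {x | T x y} ≤ Fintype.card S / 2 ^ (n * γ) := by
    calc mass P {x | T x y}
        ≤ ∑ s, mass P {x | ratioTest P (memoryless (J s)) (2 ^ (n * γ)) x y} := by
          rw [Set.ofPred_exists]
          exact mass_iUnion_le hP.1 _
      _ ≤ ∑ _s : S, 1 / 2 ^ (n * γ) := Finset.sum_le_sum fun s _ =>
          mass_ratioTest_le hP.1 (fun x => (isChannel_memoryless (hJ s) x).1)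
            (Real.rpow_pos_of_pos two_pos _) y
      _ = Fintype.card S / 2 ^ (n * γ) := by
          rw [Finset.sum_const, Finset.card_univ, nsmul_eq_mul, mul_one_div]
  have hmiss := (expect_mono hP.1 fun x _ => mass_mono (isChannel_memoryless (hJ s) x).1
    fun y _ (hy : ¬T x y) => not_exists.1 hy s).trans (expect_mass_not_ratioTest_le hN (hJ s) hγ)
  rw [← expect_const (uniform_mem_pmfs (A := Fin M)) (_ + _)]
  refine (expect_comm _ _ _).trans_le (expect_mono uniform_mem_pmfs.1 fun m _ => ?_)
  refine (expect_mass_testDecoder_ne_le hP (isChannel_memoryless (hJ s)) hT m).trans ?_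
  rw [Fintype.card_fin]
  exact add_le_add_left hmiss _

theorem expect_deviation_ofCodebook_le {Y S : Type*} [NeZero M] [NeZero n] {N : X → ℝ}
    (hN : N ∈ pmfs X) (J : S → X → Y → ℝ) (γ : ℝ) {K : X → Z → ℝ} (hK : IsChannel K) :
    expect (prodMass fun _ : Fin M => prodMass fun _ : Fin n => N)
        (fun e => (Code.ofCodebook N J γ e).deviation K (output N K)) ≤
      (Fintype.card Z : ℝ) ^ 2 / n := by
  set f : (Fin n → Z) → ℝ := fun z => variational (output N K) (seqType z) ^ 2
  have hword (m : Fin M) : expect (prodMass fun _ : Fin M => prodMass fun _ : Fin n => N)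
      (fun e => expect (memoryless K (e m)) f) ≤ (Fintype.card Z : ℝ) ^ 2 / n := by
    rw [expect_prodMass_apply (fun _ => prodMass_mem_pmfs fun _ => hN) m
      fun x => expect (memoryless K x) f, ← expect_output, output_prodMass]
    exact expect_variational_sq_le (output_mem_pmfs hN hK)
  simp only [Code.deviation, Code.blockOutput, expect_output]
  rw [expect_comm, ← expect_const (uniform_mem_pmfs (A := Fin M)) (_ / _)]
  exact expect_mono uniform_mem_pmfs.1 fun m _ => hword m

theorem exists_code_errorProb_add_deviation_le [NeZero M] [NeZero n] {N : X → ℝ} (hN : N ∈ pmfs X)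
    {J : S → X → Y → ℝ} (hJ : ∀ s, IsChannel (J s)) {K : S → X → Z → ℝ}
    (hK : ∀ s, IsChannel (K s)) {γ : ℝ} (hγ : ∀ s, γ < mutualInfo (joint N (J s))) :
    ∃ c : Code X Y M n, ∀ s, c.errorProb (J s) + c.deviation (K s) (output N (K s)) ≤
      ∑ s, (variance (joint N (J s)) (infoDensity N (J s)) /
        (mutualInfo (joint N (J s)) - γ) ^ 2 / n + (M - 1) * (Fintype.card S / 2 ^ (n * γ)) +
          (Fintype.card Z : ℝ) ^ 2 / n) := by
  have hword : prodMass (fun _ : Fin n => N) ∈ pmfs (Fin n → X) := prodMass_mem_pmfs fun _ => hN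
  obtain ⟨e, he⟩ := exists_forall_le_of_expect_le
    (prodMass_mem_pmfs fun _ : Fin M => hword)
    (F := fun s e => (Code.ofCodebook N J γ e).errorProb (J s) +
      (Code.ofCodebook N J γ e).deviation (K s) (output N (K s)))
    (fun s e => add_nonneg (Code.errorProb_nonneg _ (hJ s)) (Code.deviation_nonneg _ (hK s) _))
    fun s => (expect_add _ _ _).trans_le (add_le_add (expect_errorProb_ofCodebook_le hN hJ (hγ s))
      (expect_deviation_ofCodebook_le hN J γ (hK s)))
  exact ⟨_, he⟩

instance neZero_numMessages (R : ℝ) (n : ℕ) : NeZero (numMessages R n) :=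
  ⟨(Nat.ceil_pos.2 (by positivity)).ne'⟩

theorem numMessages_sub_one_le (R : ℝ) (n : ℕ) : (numMessages R n : ℝ) - 1 ≤ 2 ^ (n * R) :=
  sub_le_iff_le_add.2 (Nat.ceil_lt_add_one (by positivity)).le

theorem prob_variational_le_deviation_div {X S : Type*} [NeZero M] {p : X × S → Y × Z → ℝ}
    (hp : IsChannel p) (s : S) (c : Code X Y M n) (Q : Z → ℝ) {ε : ℝ} (hε : 0 < ε) :
    prob p s c (fun _ _ z => ε ≤ variational Q (seqType z)) ≤
      c.deviation (chanZ p s) Q / ε ^ 2 := by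
  have hpmf := c.blockOutput_mem_pmfs (isChannel_chanZ hp s)
  rw [le_div_iff₀' (by positivity)]
  refine le_trans (mul_le_mul_of_nonneg_left ?_ (sq_nonneg ε))
    (mul_mass_le_expect hpmf.1 (fun _ => sq_nonneg _) (ε ^ 2))
  refine (prob_interference p s c _).trans_le (mass_mono hpmf.1 fun z _ hz => ?_)
  exact pow_le_pow_left₀ hε.le hz 2

theorem multiplyAchievable_of_errorProb_add_deviation_le {X S : Type*} [Nonempty S]
    {p : X × S → Y × Z → ℝ} (hp : IsChannel p) {R : ℝ} {Q : S → Z → ℝ} {δ : ℕ → ℝ}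
    (hδ : Tendsto δ atTop (𝓝 0))
    (h : ∀ n, 0 < n → ∃ c : Code X Y (numMessages R n) n, ∀ s,
      c.errorProb (chanY p s) + c.deviation (chanZ p s) (Q s) ≤ δ n) :
    MultiplyAchievable p R Q := by
  have h' (n : ℕ) : ∃ c : Code X Y (numMessages R n) n, 0 < n → ∀ s,
      c.errorProb (chanY p s) + c.deviation (chanZ p s) (Q s) ≤ δ n := by
    rcases n.eq_zero_or_pos with rfl | hn
    · exact ⟨⟨fun _ => Fin.elim0, fun _ => 0⟩, fun h => absurd h (lt_irrefl 0)⟩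
    · exact (h n hn).imp fun _ hc _ => hc
  choose c hc using h'
  have herr (n : ℕ) (s : S) : 0 ≤ (c n).errorProb (chanY p s) :=
    (c n).errorProb_nonneg (isChannel_chanY hp s)
  have hdev (n : ℕ) (s : S) : 0 ≤ (c n).deviation (chanZ p s) (Q s) :=
    (c n).deviation_nonneg (isChannel_chanZ hp s) (Q s)
  refine ⟨c, squeeze_zero' (.of_forall fun n => Real.iSup_nonneg fun s => ?_) ?_ hδ,
    fun s ε hε => squeeze_zero' (.of_forall fun n => ?_) ?_
      (g := fun n => δ n / ε ^ 2) (by simpa using hδ.div_const (ε ^ 2))⟩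
  · exact (herr n s).trans_eq (prob_dec_ne p s (c n)).symm
  · filter_upwards [eventually_gt_atTop 0] with n hn
    refine ciSup_le fun s => (prob_dec_ne p s (c n)).trans_le ?_
    exact (le_add_of_nonneg_right (hdev n s)).trans (hc n hn s)
  · exact (mass_nonneg ((c n).blockOutput_mem_pmfs (isChannel_chanZ hp s)).1 _).trans_eq
      (prob_interference p s (c n) {z | ε ≤ variational (Q s) (seqType z)}).symm
  · filter_upwards [eventually_gt_atTop 0] with n hn
    refine (prob_variational_le_deviation_div hp s (c n) (Q s) hε).trans ?_
    gcongr
    exact (le_add_of_nonneg_left (herr n s)).trans (hc n hn s)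

end RandomCode

section Achievability

variable {X Y Z S : Type*} [Fintype X] [Fintype Y] [Fintype Z] [Finite S] [Nonempty S]
  {p : X × S → Y × Z → ℝ}

theorem multiplyAchievable_of_tendsto (hp : IsChannel p) {N : X → ℝ} (hN : N ∈ pmfs X) {γ R : ℝ}
    (hγ : γ < minInfo p N)
    (hR : Tendsto (fun n : ℕ => ((numMessages R n : ℝ) - 1) / 2 ^ (n * γ)) atTop (𝓝 0)) :
    MultiplyAchievable p R fun s => output N (chanZ p s) := by
  cases nonempty_fintype S
  have hsum (C D : ℝ) : Tendsto (fun n : ℕ => C / n +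
      ((numMessages R n : ℝ) - 1) * (Fintype.card S / 2 ^ (n * γ)) + D / n) atTop (𝓝 0) := by
    simpa only [mul_zero, add_zero, mul_div_left_comm] using
      ((tendsto_const_div_atTop_nhds_zero_nat C).add (hR.const_mul (Fintype.card S : ℝ))).add
        (tendsto_const_div_atTop_nhds_zero_nat D)
  refine multiplyAchievable_of_errorProb_add_deviation_le hp ?_ fun n hn =>
    have : NeZero n := ⟨hn.ne'⟩
    exists_code_errorProb_add_deviation_le hN (isChannel_chanY hp) (isChannel_chanZ hp)
      fun s => hγ.trans_le (minInfo_le N s)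
  rw [← Finset.sum_const_zero (s := (Finset.univ : Finset S)) (M := ℝ)]
  refine tendsto_finsetSum _ fun s _ => ?_
  exact hsum _ _

theorem multiplyAchievable_of_lt_minInfo (hp : IsChannel p) {N : X → ℝ} (hN : N ∈ pmfs X) {R : ℝ}
    (hR : R < minInfo p N) : MultiplyAchievable p R fun s => output N (chanZ p s) := by
  obtain ⟨γ, hRγ, hγ⟩ := exists_between hR
  have hlt : (2 : ℝ) ^ (R - γ) < 1 :=
    Real.rpow_lt_one_of_one_lt_of_neg one_lt_two (sub_neg.2 hRγ)
  refine multiplyAchievable_of_tendsto hp hN hγ (squeeze_zero (fun n => ?_) (fun n => ?_)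
    (tendsto_pow_atTop_nhds_zero_of_lt_one (by positivity) hlt))
  · exact div_nonneg (sub_nonneg.2 (Nat.one_le_cast.2 NeZero.one_le)) (by positivity)
  · calc ((numMessages R n : ℝ) - 1) / 2 ^ (n * γ) ≤ 2 ^ (n * R) / 2 ^ (n * γ) := by
          gcongr
          exact numMessages_sub_one_le R n
      _ = (2 ^ (R - γ)) ^ n := by
          rw [← Real.rpow_sub two_pos, ← mul_sub, mul_comm, Real.rpow_mul_natCast two_pos.le]

theorem multiplyAchievable_zero (hp : IsChannel p) {N : X → ℝ} (hN : N ∈ pmfs X) :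
    MultiplyAchievable p 0 fun s => output N (chanZ p s) :=
  multiplyAchievable_of_tendsto hp hN (sub_one_lt (minInfo p N)) (by simp [numMessages])

end Achievability

section Converse

variable {X Y Z S : Type*} [Fintype X] [Fintype Y] [Fintype Z] {M n : ℕ}

theorem logb_div_guess_le {w v k : ℝ} (hw : 0 < w) (hv : 0 < v) (hk : 0 < k) (q : Prop)
    [Decidable q] :
    Real.logb 2 (k⁻¹ * w / (v * ((k⁻¹ + if q then 1 else 0) / 2))) ≤
      Real.logb 2 (w / v) + (1 - (if q then 1 else 0) * Real.logb 2 k) := by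
  have h2 : Real.logb 2 2 = 1 := Real.logb_self_eq_one one_lt_two
  split_ifs
  · calc Real.logb 2 (k⁻¹ * w / (v * ((k⁻¹ + 1) / 2)))
        ≤ Real.logb 2 (k⁻¹ * w / (v * (1 / 2))) := by
          gcongr
          · exact one_lt_two
          · exact le_add_of_nonneg_left (inv_pos.2 hk).le
      _ = Real.logb 2 (w / v * 2 / k) := by congr 1; field_simp
      _ = Real.logb 2 (w / v) + (1 - 1 * Real.logb 2 k) := by
          rw [Real.logb_div (by positivity) hk.ne', Real.logb_mul (by positivity) two_ne_zero, h2]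
          ring
  · refine le_of_eq ?_
    rw [add_zero, zero_mul, sub_zero, ← h2, ← Real.logb_mul (by positivity) two_ne_zero]
    congr 1
    field_simp

-- Gibbs' inequality for the pair of a uniform message and its channel output, against the pair of
-- an output drawn from `V` and a guess that follows `d` or is uniform, each with probability `1/2`.
theorem mass_decode_mul_logb_sub_one_le {κ B : Type*} [Fintype κ] [Nonempty κ] [Fintype B]
    {W : κ → B → ℝ} (hW : IsChannel W) {V : B → ℝ} (hV : V ∈ pmfs B)
    (hWV : ∀ m b, 0 < W m b → 0 < V b) (d : B → κ) :
    expect (uniform κ) (fun m => mass (W m) {b | d b = m}) * Real.logb 2 (Fintype.card κ) - 1 ≤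
      expect (uniform κ) fun m => divergence (W m) V := by
  classical
  set k : ℝ := (Fintype.card κ : ℝ) with hk
  have hk0 : 0 < k := Nat.cast_pos.2 Fintype.card_pos
  have hP : joint (uniform κ) W ∈ pmfs (κ × B) := joint_mem_pmfs uniform_mem_pmfs hW
  let guess : κ × B → ℝ := fun mb => V mb.2 * ((k⁻¹ + if d mb.2 = mb.1 then 1 else 0) / 2)
  have hguess : guess ∈ pmfs (κ × B) := by
    refine ⟨fun mb => mul_nonneg (hV.1 _) (by positivity), ?_⟩
    simp only [guess, Fintype.sum_prod_type_right, ← Finset.mul_sum, ← Finset.sum_div,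
      Finset.sum_add_distrib, Finset.sum_const, Finset.card_univ, nsmul_eq_mul, ← hk,
      mul_inv_cancel₀ hk0.ne', Finset.sum_ite_eq, Finset.mem_univ, if_true]
    norm_num [hV.2]
  have hWpos {mb : κ × B} (h : 0 < joint (uniform κ) W mb) : 0 < W mb.1 mb.2 :=
    pos_of_mul_pos_right h (uniform_mem_pmfs.1 _)
  have hgibbs : 0 ≤ divergence (joint (uniform κ) W) guess :=
    divergence_nonneg hP hguess fun mb h => mul_pos (hWV _ _ (hWpos h)) (by positivity)
  have hle : divergence (joint (uniform κ) W) guess ≤ expect (joint (uniform κ) W) fun mb =>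
      Real.logb 2 (W mb.1 mb.2 / V mb.2) +
        (1 - (if d mb.2 = mb.1 then 1 else 0) * Real.logb 2 k) :=
    expect_mono hP.1 fun mb h => logb_div_guess_le (hWpos h) (hWV _ _ (hWpos h)) hk0 _
  rw [expect_add, expect_sub, expect_const hP, expect_mul_const, expect_joint, expect_joint] at hle
  have hmass (m : κ) : expect (W m) (fun b => if d b = m then 1 else 0) =
      mass (W m) {b | d b = m} := by
    refine congrArg _ (funext fun b => ?_)
    by_cases hb : d b = m <;> simp [hb]
  simp only [hmass] at hle
  unfold divergence at hle hgibbs ⊢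
  linarith

theorem Code.meanType_mem_pmfs {Y : Type*} [NeZero M] [NeZero n] (c : Code X Y M n) :
    c.meanType ∈ pmfs X :=
  output_mem_pmfs uniform_mem_pmfs fun _ => seqType_mem_pmfs (NeZero.pos n) _

theorem Code.meanType_pos {X Y : Type*} [Finite X] (c : Code X Y M n) (m : Fin M) (i : Fin n) :
    0 < c.meanType (c.enc m i) := by
  cases nonempty_fintype X
  have : NeZero M := ⟨m.pos.ne'⟩
  have hocc : 0 < occ (c.enc m) (c.enc m i) := Finset.card_pos.2 ⟨i, by simp⟩
  refine output_pos uniform_mem_pmfs.1 (fun _ => seqType_mem_pmfs i.pos _) (a := m) ?_ ?_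
  · rw [uniform, Fintype.card_fin]
    exact inv_pos.2 (Nat.cast_pos.2 m.pos)
  · exact div_pos (Nat.cast_pos.2 hocc) (Nat.cast_pos.2 i.pos)

theorem Code.expect_meanType {Y : Type*} (c : Code X Y M n) (f : X → ℝ) :
    expect c.meanType f =
      expect (uniform (Fin M)) fun m => expect (uniform (Fin n)) fun i => f (c.enc m i) := by
  simp only [Code.meanType, expect_output, expect_seqType]

theorem Code.one_sub_errorProb {X : Type*} [NeZero M] (c : Code X Y M n) {J : X → Y → ℝ}
    (hJ : IsChannel J) :
    1 - c.errorProb J =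
      expect (uniform (Fin M)) fun m => mass (memoryless J (c.enc m)) {y | c.dec y = m} := by
  rw [errorProb, ← expect_const (uniform_mem_pmfs (A := Fin M)) 1, ← expect_sub]
  refine congrArg _ (funext fun m => ?_)
  rw [← mass_compl (isChannel_memoryless hJ _)]
  simp only [Set.compl_def, Set.mem_ofPred_eq, not_not]

theorem Code.expect_divergence_memoryless [NeZero n] (c : Code X Y M n) {J : X → Y → ℝ}
    (hJ : IsChannel J) :
    expect (uniform (Fin M)) (fun m => divergence (memoryless J (c.enc m))
        (prodMass fun _ => output c.meanType J)) =
      n * mutualInfo (joint c.meanType J) := by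
  have hpos (m : Fin M) (i : Fin n) (b : Y) (hb : 0 < J (c.enc m i) b) :
      0 < output c.meanType J b := by
    have : NeZero M := ⟨m.pos.ne'⟩
    exact output_pos c.meanType_mem_pmfs.1 hJ (c.meanType_pos m i) hb
  have hn : (n : ℝ) ≠ 0 := NeZero.ne _
  rw [mutualInfo_joint_eq_expect_divergence _ hJ, c.expect_meanType, ← expect_const_mul]
  refine congrArg _ (funext fun m => ?_)
  rw [expect_uniform, Fintype.card_fin, mul_div_cancel₀ _ hn]
  exact divergence_prodMass (fun i => hJ _) (hpos m)

theorem Code.one_sub_errorProb_mul_logb_sub_one_le [NeZero M] [NeZero n] (c : Code X Y M n)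
    {J : X → Y → ℝ} (hJ : IsChannel J) :
    (1 - c.errorProb J) * Real.logb 2 M - 1 ≤ n * mutualInfo (joint c.meanType J) := by
  have hq : output c.meanType J ∈ pmfs Y := output_mem_pmfs c.meanType_mem_pmfs hJ
  have hfano := mass_decode_mul_logb_sub_one_le (W := fun m => memoryless J (c.enc m))
    (fun m => isChannel_memoryless hJ _) (prodMass_mem_pmfs fun _ : Fin n => hq)
    (fun m y hy => Finset.prod_pos fun i _ => output_pos c.meanType_mem_pmfs.1 hJ
      (c.meanType_pos m i) (prodMass_pos (fun _ => (hJ _).1) hy i)) c.dec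
  rwa [← c.one_sub_errorProb hJ, c.expect_divergence_memoryless hJ, Fintype.card_fin] at hfano

theorem Code.output_meanType {Y : Type*} (c : Code X Y M n) {K : X → Z → ℝ} (hK : IsChannel K)
    (k : Z) : output c.meanType K k = expect (c.blockOutput K) fun z => seqType z k := by
  change expect c.meanType (fun a => K a k) = _
  rw [c.expect_meanType, Code.blockOutput, expect_output]
  refine congrArg _ (funext fun m => ?_)
  simp only [seqType_eq_expect]
  rw [expect_comm]
  refine congrArg _ (funext fun i => ?_)
  rw [memoryless, expect_prodMass_apply (fun _ => hK _) i]
  exact (mass_singleton _ k).symm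

theorem abs_sub_le_one_of_mem_pmfs {A : Type*} [Fintype A] {P Q : A → ℝ} (hP : P ∈ pmfs A)
    (hQ : Q ∈ pmfs A) (a : A) : |P a - Q a| ≤ 1 := by
  rw [← mass_singleton P, ← mass_singleton Q]
  exact abs_sub_le_of_nonneg_of_le (mass_nonneg hP.1 _) (mass_le_one hP _)
    (mass_nonneg hQ.1 _) (mass_le_one hQ _)

theorem abs_output_meanType_sub_le {X Y Z S : Type*} [Fintype X] [Fintype Y] [Fintype Z]
    [NeZero M] [NeZero n] {p : X × S → Y × Z → ℝ} (hp : IsChannel p) (s : S) (c : Code X Y M n)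
    {Q : Z → ℝ} (hQ : Q ∈ pmfs Z) {ε : ℝ} (hε : 0 ≤ ε) (k : Z) :
    |output c.meanType (chanZ p s) k - Q k| ≤
      ε + prob p s c fun _ _ z => ε ≤ variational Q (seqType z) := by
  have hK := isChannel_chanZ hp s
  rw [c.output_meanType hK]
  have hbound (z : Fin n → Z) : |seqType z k - Q k| ≤ 1 :=
    abs_sub_le_one_of_mem_pmfs (seqType_mem_pmfs (NeZero.pos n) z) hQ k
  refine (abs_expect_sub_le (c.blockOutput_mem_pmfs hK) hε
    (E := {z | ε ≤ variational Q (seqType z)}) hbound fun z hz => ?_).trans_eq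
      (congrArg _ (prob_interference p s c _).symm)
  rw [abs_sub_comm]
  exact (Finset.single_le_sum (f := fun k => |Q k - seqType z k|) (fun _ _ => abs_nonneg _)
    (Finset.mem_univ k)).trans (not_le.1 hz).le

variable {p : X × S → Y × Z → ℝ}

theorem tendsto_errorProb {X S : Type*} [Finite S] {p : X × S → Y × Z → ℝ}
    (hp : IsChannel p) {R : ℝ} {c : (n : ℕ) → Code X Y (numMessages R n) n}
    (hc : Tendsto (fun n => ⨆ s, prob p s (c n) fun m y _ => (c n).dec y ≠ m) atTop (𝓝 0)) (s : S) :
    Tendsto (fun n => (c n).errorProb (chanY p s)) atTop (𝓝 0) :=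
  squeeze_zero (fun n => (c n).errorProb_nonneg (isChannel_chanY hp s))
    (fun n => (prob_dec_ne p s (c n)).symm.trans_le (le_ciSup
      (f := fun s => prob p s (c n) fun m y _ => (c n).dec y ≠ m)
      (Set.finite_range _).bddAbove s)) hc

theorem tendsto_output_meanType (hp : IsChannel p) {R : ℝ} {Q : S → Z → ℝ}
    {c : (n : ℕ) → Code X Y (numMessages R n) n} {s : S} (hQ : Q s ∈ pmfs Z)
    (hc : ∀ ε > 0, Tendsto (fun n => prob p s (c n) fun _ _ z => ε ≤ variational (Q s) (seqType z))
      atTop (𝓝 0)) :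
    Tendsto (fun n => output (c n).meanType (chanZ p s)) atTop (𝓝 (Q s)) := by
  refine tendsto_pi_nhds.2 fun k => Metric.tendsto_nhds.2 fun ε hε => ?_
  filter_upwards [eventually_gt_atTop 0, (hc (ε / 2) (half_pos hε)).eventually_lt_const
    (half_pos hε)] with n hn hprob
  have : NeZero n := ⟨hn.ne'⟩
  rw [Real.dist_eq]
  exact (abs_output_meanType_sub_le hp s (c n) hQ (half_pos hε).le k).trans_lt
    ((add_lt_add_right hprob _).trans_eq (add_halves ε))

theorem Code.one_sub_errorProb_mul_sub_le [NeZero n] {R : ℝ} (c : Code X Y (numMessages R n) n)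
    {J : X → Y → ℝ} (hJ : IsChannel J) :
    (1 - c.errorProb J) * R - 1 / n ≤ mutualInfo (joint c.meanType J) := by
  have hn : (0 : ℝ) < n := Nat.cast_pos.2 (NeZero.pos n)
  have hrate : n * R ≤ Real.logb 2 (numMessages R n) :=
    (Real.le_logb_iff_rpow_le one_lt_two (Nat.cast_pos.2 (NeZero.pos _))).2 (Nat.le_ceil _)
  have herr : 0 ≤ 1 - c.errorProb J := by
    rw [c.one_sub_errorProb hJ]
    exact expect_nonneg uniform_mem_pmfs.1 fun _ => mass_nonneg (isChannel_memoryless hJ _).1 _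
  refine le_of_mul_le_mul_left ?_ hn
  calc n * ((1 - c.errorProb J) * R - 1 / n) = (1 - c.errorProb J) * (n * R) - 1 := by field_simp
    _ ≤ (1 - c.errorProb J) * Real.logb 2 (numMessages R n) - 1 := by gcongr
    _ ≤ n * mutualInfo (joint c.meanType J) := c.one_sub_errorProb_mul_logb_sub_one_le hJ

theorem MultiplyAchievable.exists_le_minInfo [Finite S] [Nonempty S] (hp : IsChannel p) {R : ℝ}
    {Q : S → Z → ℝ} (hQ : ∀ s, Q s ∈ pmfs Z) (h : MultiplyAchievable p R Q) :
    ∃ N ∈ admissibleInputs p Q, R ≤ minInfo p N := by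
  obtain ⟨c, herr, hint⟩ := h
  have hmem : ∀ᶠ n in atTop, (c n).meanType ∈ pmfs X := by
    filter_upwards [eventually_gt_atTop 0] with n hn
    have : NeZero n := ⟨hn.ne'⟩
    exact (c n).meanType_mem_pmfs
  obtain ⟨N, hN, φ, hφ, hlim⟩ := isCompact_pmfs.tendsto_subseq' hmem.frequently
  have hlim' : Tendsto (fun j => (c (φ j)).meanType) atTop (𝓝[pmfs X] N) :=
    tendsto_nhdsWithin_iff.2 ⟨hlim, hφ.tendsto_atTop.eventually hmem⟩
  refine ⟨N, ⟨hN, fun s => ?_⟩, le_ciInf fun s => ?_⟩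
  · exact tendsto_nhds_unique (((continuous_output (chanZ p s)).tendsto N).comp hlim)
      ((tendsto_output_meanType hp (hQ s) (hint s)).comp hφ.tendsto_atTop)
  · have hJ : IsChannel (chanY p s) := isChannel_chanY hp s
    have hrate : Tendsto (fun n => (1 - (c n).errorProb (chanY p s)) * R - 1 / n) atTop (𝓝 R) := by
      simpa using (((tendsto_errorProb hp herr s).const_sub 1).mul_const R).sub
        tendsto_one_div_atTop_nhds_zero_nat
    refine le_of_tendsto_of_tendsto (hrate.comp hφ.tendsto_atTop)
      ((continuousOn_mutualInfo hJ N hN).tendsto.comp hlim') ?_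
    filter_upwards [hφ.tendsto_atTop.eventually_gt_atTop 0] with j hj
    have : NeZero (φ j) := ⟨hj.ne'⟩
    exact (c (φ j)).one_sub_errorProb_mul_sub_le hJ

end Converse

section Region

variable {X Y Z S : Type*} [Fintype X] [Fintype Y] [Fintype Z] [Finite S] [Nonempty S]
  {p : X × S → Y × Z → ℝ}

theorem capacityRegion_subset (hp : IsChannel p)
    (hK : ∀ s a k, chanZ p s a k ∈ (Rat.castHom ℝ).fieldRange) :
    capacityRegion p ⊆ closure {t : ℝ × (S → Z → ℝ) | 0 ≤ t.1 ∧ (∀ s, t.2 s ∈ types Z) ∧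
      (commonPreimage p t.2).Nonempty ∧ t.1 ≤ sSup (minInfo p '' commonPreimage p t.2)} := by
  refine closure_mono fun ⟨R, Q⟩ ⟨hR, hQ, hach⟩ => ?_
  obtain ⟨N, hN, hRN⟩ := hach.exists_le_minInfo hp fun s => (mem_types_iff.1 (hQ s)).1
  have hne : (commonPreimage p Q).Nonempty :=
    closure_nonempty_iff.1 ⟨N, admissibleInputs_subset_closure hK hQ hN⟩
  obtain ⟨v, hlub, hmax⟩ := exists_isLUB_isGreatest_minInfo hp hK hQ hne
  refine ⟨hR, hQ, hne, ?_⟩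
  rw [hlub.csSup_eq (hne.image _)]
  exact hRN.trans (hmax.2 (Set.mem_image_of_mem _ hN))

theorem mem_capacityRegion (hp : IsChannel p) {R : ℝ} (hR : 0 ≤ R) {Q : S → Z → ℝ}
    (hQ : ∀ s, Q s ∈ types Z) {N : X → ℝ} (hN : N ∈ admissibleInputs p Q)
    (hRN : R ≤ minInfo p N) : (R, Q) ∈ capacityRegion p := by
  obtain ⟨hpmf, hNQ⟩ := hN
  obtain rfl : (fun s => output N (chanZ p s)) = Q := funext hNQ
  rcases hR.eq_or_lt with rfl | hpos
  · exact subset_closure ⟨le_rfl, hQ, multiplyAchievable_zero hp hpmf⟩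
  · have hmem : R ∈ closure (Set.Ico 0 R) := by
      rw [closure_Ico hpos.ne]
      exact Set.right_mem_Icc.2 hR
    exact map_mem_closure (f := fun R' => (R', _)) (Continuous.prodMk_left _) hmem fun R' hR' =>
      ⟨hR'.1, hQ, multiplyAchievable_of_lt_minInfo hp hpmf (hR'.2.trans_le hRN)⟩

end Region

end CompoundInterference

end

open CompoundInterference in
theorem theorem1_general {X Y Z S : Type*} [Fintype X] [Fintype Y] [Fintype Z] [Finite S]
    [Nonempty S] (p : X × S → Y × Z → ℝ) (hp : IsChannel p)
    (hK : ∀ s a k, chanZ p s a k ∈ (Rat.castHom ℝ).fieldRange) :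
    capacityRegion p =
        closure {t : ℝ × (S → Z → ℝ) | 0 ≤ t.1 ∧ (∀ s, t.2 s ∈ types Z) ∧
          (commonPreimage p t.2).Nonempty ∧ t.1 ≤ sSup (minInfo p '' commonPreimage p t.2)} ∧
      ∀ Q : S → Z → ℝ, (∀ s, Q s ∈ types Z) → (commonPreimage p Q).Nonempty →
        ∃ v : ℝ, IsLUB (minInfo p '' commonPreimage p Q) v ∧
          IsGreatest (minInfo p '' {N | N ∈ pmfs X ∧ ∀ s, output N (chanZ p s) = Q s}) v := by
  refine ⟨(capacityRegion_subset hp hK).antisymm (closure_minimal ?_ isClosed_closure),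
    fun Q => exists_isLUB_isGreatest_minInfo hp hK⟩
  rintro ⟨R, Q⟩ ⟨hR, hQ, hne, hle⟩
  obtain ⟨v, hlub, ⟨N, hN, hNv⟩, -⟩ := exists_isLUB_isGreatest_minInfo hp hK hQ hne
  rw [hlub.csSup_eq (hne.image _), ← hNv] at hle
  exact mem_capacityRegion hp hR hQ hN hle

open CompoundInterference in
theorem theorem1 {X Y Z S : Type*} [Fintype X] [Fintype Y] [Fintype Z] [Fintype S] [Nonempty S]
    (p : X × S → Y × Z → ℝ) (hp : p ∈ condTypes (X × S) (Y × Z)) :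
    capacityRegion p =
        closure {t : ℝ × (S → Z → ℝ) | 0 ≤ t.1 ∧ (∀ s, t.2 s ∈ types Z) ∧
          (commonPreimage p t.2).Nonempty ∧ t.1 ≤ sSup (minInfo p '' commonPreimage p t.2)} ∧
      ∀ Q : S → Z → ℝ, (∀ s, Q s ∈ types Z) → (commonPreimage p Q).Nonempty →
        ∃ v : ℝ, IsLUB (minInfo p '' commonPreimage p Q) v ∧
          IsGreatest (minInfo p '' {N | N ∈ pmfs X ∧ ∀ s, output N (chanZ p s) = Q s}) v := by
  exact theorem1_general p (isChannel_of_mem_condTypes hp) fun _ _ _ =>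
    sum_mem fun _ _ => mem_fieldRange_of_mem_condTypes hp _ _
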